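/- For $n\ge 0$ let $H_n=\sum_{k=1}^n\frac1k$ ($H_0=0$), $(x)_0=1$, $(x)_k=x(x+1)\cdots(x+k-1)$, $\binom{x}{k}=\frac{x(x-1)\cdots(x-k+1)}{k!}$ for complex $x$, and for a nonnegative integer $i$ \[{}_4F_3\!\left(\begin{matrix}-i,\alpha,\beta,\gamma\\ \delta,\epsilon,\zeta\end{matrix};1\right)=\sum_{j=0}^{i}\frac{(-i)_j(\alpha)_j(\beta)_j(\gamma)_j}{j!\,(\delta)_j(\epsilon)_j(\zeta)_j}.\] For nonnegative integers $n$, $P_1,\dots,P_6$ and $0\le v\le 6$ put \[\begin{aligned}S_{n,v}(P_1,\dots,P_6)=\sum_{k=0}^n&\binom nk^2\prod_{s=1}^{v}\frac{\binom{k+P_s}{k}}{\binom{n+P_s}{k}}\prod_{s=v+1}^{6}\frac{\binom{n+P_s}{k}}{\binom{k+P_s}{k}}\\&\times\Big\{1+(n-2k)\Big(2H_k-\sum_{s=1}^vH_{k+P_s}+\sum_{s=v+1}^6H_{k+P_s}\Big)\Big\},\end{aligned}\] and for complex $T=(T_1,\dots,T_6)$ put \[\begin{aligned}R_n(T)=&\frac{(-n)_n(1-n-T_5-T_6)_n}{(1-n-T_5)_n(1-n-T_6)_n}\sum_{i=0}^n\frac{(-n)_i(T_5)_i(T_6)_i(1-n-T_3-T_4)_i}{(1)_i(T_5+T_6)_i(1-n-T_3)_i(1-n-T_4)_i}\\&\times{}_4F_3\!\left(\begin{matrix}-i,\;T_3,\;T_4,\;1-n-T_1-T_2\\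 T_3+T_4+n-i,\;1-n-T_1,\;1-n-T_2\end{matrix};1\right).\end{aligned}\] **(A)** Let $T_s=1+P_s$ for $1\le s\le v$ and $T_s=-n-P_s$ for $v+1\le s\le 6$. Unless ($v=3$ and $0\le P_3-P_4\le n-1$) or ($v=5$ and $0\le P_5-P_6\le n-1$), no denominator in $R_n(T)$ vanishes and \[S_{n,v}(P_1,\dots,P_6)=R_n(T).\] In all cases, $T$ is in the closure of the set of $T'\in\mathbb C^6$ for which no denominator in $R_n(T')$ vanishes, and $R_n(T')\to S_{n,v}(P_1,\dots,P_6)$ as $T'\to T$ within this set. **(B)** For all nonnegative integers $n,b,c,d,e,f,g$, writing $S_v=S_{n,v}(b,c,d,e,f,g)$: \[S_6=\frac{\binom{1+b+c+n}{n}}{\binom{n+b}{n}\binom{n+c}{n}}\sum_{i=0}^n\binom ni\frac{\binom{i+b}{i}\binom{i+c}{i}\binom{1+d+e+n}{i}}{\binom{n+d}{i}\binom{n+e}{i}\binom{1+b+c+i}{i}}\sum_{j=0}^i\binom ij\frac{\binom{j+d}{j}\binom{j+e}{j}\binom{1+f+g+n}{j}}{\binom{n+f}{j}\binom{n+g}{j}\binom{1+d+e+n-i+j}{j}},\]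 \[S_5=\frac{\binom{1+b+c+n}{n}}{\binom{n+b}{n}\binom{n+c}{n}}\sum_{i=0}^n\binom ni\frac{\binom{i+b}{i}\binom{i+c}{i}\binom{1+d+e+n}{i}}{\binom{n+d}{i}\binom{n+e}{i}\binom{1+b+c+i}{i}}\sum_{j=0}^i(-1)^j\binom ij\frac{\binom{j+d}{j}\binom{j+e}{j}\binom{f-g}{j}}{\binom{n+f}{j}\binom{j+g}{j}\binom{1+d+e+n-i+j}{j}},\] \[S_4=\frac{\binom{1+b+c+n}{n}}{\binom{n+b}{n}\binom{n+c}{n}}\sum_{i=0}^n\binom ni\frac{\binom{i+b}{i}\binom{i+c}{i}\binom{1+d+e+n}{i}}{\binom{n+d}{i}\binom{n+e}{i}\binom{1+b+c+i}{i}}\sum_{j=0}^i(-1)^j\binom ij\frac{\binom{j+d}{j}\binom{j+e}{j}\binom{n+f+g+j}{j}}{\binom{j+f}{j}\binom{j+g}{j}\binom{1+d+e+n-i+j}{j}},\] \[S_3=\frac{\binom{1+b+c+n}{n}}{\binom{n+b}{n}\binom{n+c}{n}}\sum_{i=0}^n(-1)^i\binom ni\frac{\binom{i+b}{i}\binom{i+c}{i}\binom{d-e}{i}}{\binom{n+d}{i}\binom{i+e}{i}\binom{1+b+c+i}{i}}\sum_{j=0}^i\binom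 ij\frac{\binom{j+d}{j}\binom{n+e}{j}\binom{j+f+g+n}{j}}{\binom{j+f}{j}\binom{j+g}{j}\binom{j+d-e-i}{j}},\] \[S_2=\frac{\binom{1+b+c+n}{n}}{\binom{n+b}{n}\binom{n+c}{n}}\sum_{i=0}^n(-1)^i\binom ni\frac{\binom{i+b}{i}\binom{i+c}{i}\binom{i+d+e+n}{i}}{\binom{i+d}{i}\binom{i+e}{i}\binom{i+b+c+1}{i}}\sum_{j=0}^i\binom ij\frac{\binom{n+d}{j}\binom{n+e}{j}\binom{j+f+g+n}{j}}{\binom{j+f}{j}\binom{j+g}{j}\binom{i+d+e+n}{j}},\] \[S_1=(-1)^n\frac{\binom{b-c}{n}}{\binom{n+b}{n}\binom{n+c}{n}}\sum_{i=0}^n\binom ni\frac{\binom{i+b}{i}\binom{n+c}{i}\binom{i+d+e+n}{i}}{\binom{i+d}{i}\binom{i+e}{i}\binom{i+b-c-n}{i}}\sum_{j=0}^i\binom ij\frac{\binom{n+d}{j}\binom{n+e}{j}\binom{j+f+g+n}{j}}{\binom{j+f}{j}\binom{j+g}{j}\binom{i+d+e+n}{j}},\] \[S_0=(-1)^n\frac{\binom{2n+b+c}{n}}{\binom{n+b}{n}\binom{n+c}{n}}\sum_{i=0}^n\binom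 ni\frac{\binom{n+b}{i}\binom{n+c}{i}\binom{i+d+e+n}{i}}{\binom{i+d}{i}\binom{i+e}{i}\binom{2n+b+c}{i}}\sum_{j=0}^i\binom ij\frac{\binom{n+d}{j}\binom{n+e}{j}\binom{j+f+g+n}{j}}{\binom{j+f}{j}\binom{j+g}{j}\binom{i+d+e+n}{j}}.\] In the formula for $S_3$ no denominator vanishes unless $0\le d-e\le n-1$, and then the right-hand side is read as its limit when $d$ is replaced by a complex $x\to d$, $x\ne d$; in the formula for $S_1$ no denominator vanishes unless $0\le b-c\le n-1$, and then the right-hand side is read as its limit when $b$ is replaced by a complex $x\to b$, $x\neq b$. (These limit formulas hold in all cases.) -/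

import Mathlib

open scoped BigOperators Topology
open Filter

noncomputable section

namespace HarmonicSum

/-- The shifted factorial `(x)_k = x (x + 1) ⋯ (x + k - 1)`. -/
def poch (x : ℂ) (k : ℕ) : ℂ := ∏ l ∈ Finset.range k, (x + (l : ℂ))

/-- The hypergeometric series with upper parameters `a`, lower parameters `b` and argument `z`.
It is only used below with an upper parameter `-i`, `i` a natural number: then the terms of index
larger than `i` vanish (also where a later denominator is zero), and the sum is finite. -/
def hypergeom (a b : List ℂ) (z : ℂ) : ℂ :=
  ∑' k : ℕ, (a.map (fun x => poch x k)).prod /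
    (poch 1 k * (b.map (fun x => poch x k)).prod) * z ^ k

/-- The harmonic number sum on the left-hand side. The parameters `P_1, …, P_6` are
`P 0, …, P 5`; those with `s ≤ v`, that is, with index `< v`, are of the first kind. -/
def harmonicSum (n v : ℕ) (P : Fin 6 → ℕ) : ℂ :=
  ∑ k ∈ Finset.range (n + 1),
    ((n.choose k : ℂ)) ^ 2 *
    (∏ s : Fin 6,
      if (s : ℕ) < v then ((k + P s).choose k : ℂ) / ((n + P s).choose k : ℂ)
      else ((n + P s).choose k : ℂ) / ((k + P s).choose k : ℂ)) *
    (1 + ((n : ℂ) - 2 * (k : ℂ)) *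
      (2 * ((harmonic k : ℚ) : ℂ) +
        ∑ s : Fin 6,
          if (s : ℕ) < v then -((harmonic (k + P s) : ℚ) : ℂ)
          else ((harmonic (k + P s) : ℚ) : ℂ)))

/-- `T_s = 1 + P_s` for `s ≤ v`, and `T_s = -n - P_s` for `v + 1 ≤ s ≤ 6`. -/
def param (n v : ℕ) (P : Fin 6 → ℕ) : Fin 6 → ℂ := fun s =>
  if (s : ℕ) < v then 1 + (P s : ℂ) else -(n : ℂ) - (P s : ℂ)

/-- The right-hand side, as a function of `T_1 = T 0, …, T_6 = T 5`. -/
def hyperSide (n : ℕ) (T : Fin 6 → ℂ) : ℂ :=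
  (poch (-(n : ℂ)) n * poch (1 - n - T 4 - T 5) n) /
    (poch (1 - n - T 4) n * poch (1 - n - T 5) n) *
  ∑ i ∈ Finset.range (n + 1),
    (poch (-(n : ℂ)) i * poch (T 4) i * poch (T 5) i * poch (1 - n - T 2 - T 3) i) /
      (poch 1 i * poch (T 4 + T 5) i * poch (1 - n - T 2) i * poch (1 - n - T 3) i) *
    hypergeom [-(i : ℂ), T 2, T 3, 1 - n - T 0 - T 1]
      [T 2 + T 3 + n - i, 1 - n - T 0, 1 - n - T 1] 1

/-- No denominator in `hyperSide n T` vanishes (in the hypergeometric series with upper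
parameter `-i`, the denominators of the terms of index `j ≤ i`). -/
def Regular (n : ℕ) (T : Fin 6 → ℂ) : Prop :=
  poch (1 - n - T 4) n ≠ 0 ∧ poch (1 - n - T 5) n ≠ 0 ∧
  ∀ i ≤ n,
    poch (T 4 + T 5) i ≠ 0 ∧ poch (1 - n - T 2) i ≠ 0 ∧ poch (1 - n - T 3) i ≠ 0 ∧
    ∀ j ≤ i,
      poch (T 2 + T 3 + n - i) j ≠ 0 ∧ poch (1 - n - T 0) j ≠ 0 ∧ poch (1 - n - T 1) j ≠ 0

/-- Right-hand side of the identity with six parameters of the first kind. -/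
def side6 (n b c d e f g : ℕ) : ℂ :=
  ((1 + b + c + n).choose n : ℂ) / (((n + b).choose n : ℂ) * ((n + c).choose n : ℂ)) *
  ∑ i ∈ Finset.range (n + 1), (n.choose i : ℂ) *
    ((((i + b).choose i : ℂ) * ((i + c).choose i : ℂ) * ((1 + d + e + n).choose i : ℂ)) /
      (((n + d).choose i : ℂ) * ((n + e).choose i : ℂ) * ((1 + b + c + i).choose i : ℂ))) *
    ∑ j ∈ Finset.range (i + 1), (i.choose j : ℂ) *
      ((((j + d).choose j : ℂ) * ((j + e).choose j : ℂ) * ((1 + f + g + n).choose j : ℂ)) /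
        (((n + f).choose j : ℂ) * ((n + g).choose j : ℂ) *
          ((1 + d + e + n - i + j).choose j : ℂ)))

/-- Right-hand side of the identity with five parameters of the first kind. -/
def side5 (n b c d e f g : ℕ) : ℂ :=
  ((1 + b + c + n).choose n : ℂ) / (((n + b).choose n : ℂ) * ((n + c).choose n : ℂ)) *
  ∑ i ∈ Finset.range (n + 1), (n.choose i : ℂ) *
    ((((i + b).choose i : ℂ) * ((i + c).choose i : ℂ) * ((1 + d + e + n).choose i : ℂ)) /
      (((n + d).choose i : ℂ) * ((n + e).choose i : ℂ) * ((1 + b + c + i).choose i : ℂ))) *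
    ∑ j ∈ Finset.range (i + 1), (-1 : ℂ) ^ j * (i.choose j : ℂ) *
      ((((j + d).choose j : ℂ) * ((j + e).choose j : ℂ) * Ring.choose ((f : ℂ) - g) j) /
        (((n + f).choose j : ℂ) * ((j + g).choose j : ℂ) *
          ((1 + d + e + n - i + j).choose j : ℂ)))

/-- Right-hand side of the identity with four parameters of the first kind. -/
def side4 (n b c d e f g : ℕ) : ℂ :=
  ((1 + b + c + n).choose n : ℂ) / (((n + b).choose n : ℂ) * ((n + c).choose n : ℂ)) *
  ∑ i ∈ Finset.range (n + 1), (n.choose i : ℂ) *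
    ((((i + b).choose i : ℂ) * ((i + c).choose i : ℂ) * ((1 + d + e + n).choose i : ℂ)) /
      (((n + d).choose i : ℂ) * ((n + e).choose i : ℂ) * ((1 + b + c + i).choose i : ℂ))) *
    ∑ j ∈ Finset.range (i + 1), (-1 : ℂ) ^ j * (i.choose j : ℂ) *
      ((((j + d).choose j : ℂ) * ((j + e).choose j : ℂ) * ((n + f + g + j).choose j : ℂ)) /
        (((j + f).choose j : ℂ) * ((j + g).choose j : ℂ) *
          ((1 + d + e + n - i + j).choose j : ℂ)))

/-- Right-hand side of the identity with three parameters of the first kind, as a function of a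
complex `d`. -/
def side3 (n b c : ℕ) (d : ℂ) (e f g : ℕ) : ℂ :=
  ((1 + b + c + n).choose n : ℂ) / (((n + b).choose n : ℂ) * ((n + c).choose n : ℂ)) *
  ∑ i ∈ Finset.range (n + 1), (-1 : ℂ) ^ i * (n.choose i : ℂ) *
    ((((i + b).choose i : ℂ) * ((i + c).choose i : ℂ) * Ring.choose (d - e) i) /
      (Ring.choose (n + d) i * ((i + e).choose i : ℂ) * ((1 + b + c + i).choose i : ℂ))) *
    ∑ j ∈ Finset.range (i + 1), (i.choose j : ℂ) *
      ((Ring.choose (j + d) j * ((n + e).choose j : ℂ) * ((j + f + g + n).choose j : ℂ)) /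
        (((j + f).choose j : ℂ) * ((j + g).choose j : ℂ) * Ring.choose (j + d - e - i) j))

/-- Right-hand side of the identity with two parameters of the first kind. -/
def side2 (n b c d e f g : ℕ) : ℂ :=
  ((1 + b + c + n).choose n : ℂ) / (((n + b).choose n : ℂ) * ((n + c).choose n : ℂ)) *
  ∑ i ∈ Finset.range (n + 1), (-1 : ℂ) ^ i * (n.choose i : ℂ) *
    ((((i + b).choose i : ℂ) * ((i + c).choose i : ℂ) * ((i + d + e + n).choose i : ℂ)) /
      (((i + d).choose i : ℂ) * ((i + e).choose i : ℂ) * ((i + b + c + 1).choose i : ℂ))) *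
    ∑ j ∈ Finset.range (i + 1), (i.choose j : ℂ) *
      ((((n + d).choose j : ℂ) * ((n + e).choose j : ℂ) * ((j + f + g + n).choose j : ℂ)) /
        (((j + f).choose j : ℂ) * ((j + g).choose j : ℂ) * ((i + d + e + n).choose j : ℂ)))

/-- Right-hand side of the identity with one parameter of the first kind, as a function of a
complex `b`. -/
def side1 (n : ℕ) (b : ℂ) (c d e f g : ℕ) : ℂ :=
  (-1 : ℂ) ^ n * (Ring.choose (b - c) n / (Ring.choose (n + b) n * ((n + c).choose n : ℂ))) *
  ∑ i ∈ Finset.range (n + 1), (n.choose i : ℂ) *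
    ((Ring.choose (i + b) i * ((n + c).choose i : ℂ) * ((i + d + e + n).choose i : ℂ)) /
      (((i + d).choose i : ℂ) * ((i + e).choose i : ℂ) * Ring.choose (i + b - c - n) i)) *
    ∑ j ∈ Finset.range (i + 1), (i.choose j : ℂ) *
      ((((n + d).choose j : ℂ) * ((n + e).choose j : ℂ) * ((j + f + g + n).choose j : ℂ)) /
        (((j + f).choose j : ℂ) * ((j + g).choose j : ℂ) * ((i + d + e + n).choose j : ℂ)))

/-- Right-hand side of the identity with no parameter of the first kind. -/
def side0 (n b c d e f g : ℕ) : ℂ :=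
  (-1 : ℂ) ^ n *
    (((2 * n + b + c).choose n : ℂ) / (((n + b).choose n : ℂ) * ((n + c).choose n : ℂ))) *
  ∑ i ∈ Finset.range (n + 1), (n.choose i : ℂ) *
    ((((n + b).choose i : ℂ) * ((n + c).choose i : ℂ) * ((i + d + e + n).choose i : ℂ)) /
      (((i + d).choose i : ℂ) * ((i + e).choose i : ℂ) * ((2 * n + b + c).choose i : ℂ))) *
    ∑ j ∈ Finset.range (i + 1), (i.choose j : ℂ) *
      ((((n + d).choose j : ℂ) * ((n + e).choose j : ℂ) * ((j + f + g + n).choose j : ℂ)) /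
        (((j + f).choose j : ℂ) * ((j + g).choose j : ℂ) * ((i + d + e + n).choose j : ℂ)))

end HarmonicSum

end

/-!
The identities are the derivative, at a point where both sides vanish, of Andrews' transformation of
a terminating very-well-poised series with three pairs of parameters `(b, c)`.

For a parameter `a`, each factor `(b)_k (c)_k / ((1 + a - b)_k (1 + a - c)_k)` of the series acts on
functions of `k` of the form `∑ i, (-k)_i (a + k)_i h_i` by an explicit triangular change of the
coefficients `h`. This is the Saalschütz summation (`saalschutz`, proved by telescoping) with
shifted parameters, see `pairRatio_mul_baileySum`. The expansion of one factor by `saalschutz`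
itself, followed by two such multiplications, expands the product of the three factors in the basis
`(-k)_i (a + k)_i`, and the coefficients are nested sums. Against the
very-well-poised weight with `N = n` only the basis function of index `n` has a nonzero sum
(`sum_vwpWeight_mul_basis`, telescoping again). Hence the series equals
`(a)_{n+1} n!` times the `n`-th coefficient (`sum_vwpWeight_mul_triple`).

At `a = -n` the factor `(a)_{n+1}` has a simple zero, so the derivative of the right-hand side there
is `(-n)_n n!` times the coefficient, which is `hyperSide`. On the left, the logarithmic derivatives
of the shifted factorials produce harmonic numbers. All other factors of a term are invariant under
`k ↦ n - k`, so that terms `n - 2k` times a symmetric function drop out (`sum_odd_eq_zero`); what is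
left is `wellPoisedSum`, a function of six complex parameters that is continuous wherever the
numbers `(1 - n - T_s)_n` do not vanish. Therefore `wellPoisedSum n T = hyperSide n T` at all
regular points (`wellPoisedSum_eq_hyperSide`). At the integral parameters of the theorem
`wellPoisedSum` is the harmonic number sum (`wellPoisedSum_param`), and its continuity there gives
the limit statements.

The seven double sums are `hyperSide` at the same six parameters with the three pairs in the
opposite order, which is harmless because `wellPoisedSum` is symmetric.
-/

namespace HarmonicSum

/-! ### Shifted factorials -/

@[simp] lemma poch_zero (x : ℂ) : poch x 0 = 1 := by simp [poch]

lemma poch_succ (x : ℂ) (k : ℕ) : poch x (k + 1) = poch x k * (x + k) := by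
  simp [poch, Finset.prod_range_succ]

lemma poch_add (x : ℂ) (j m : ℕ) : poch x (j + m) = poch x j * poch (x + j) m := by
  simp [poch, Finset.prod_range_add, add_assoc]

lemma poch_succ_left (x : ℂ) (k : ℕ) : poch x (k + 1) = x * poch (x + 1) k := by
  rw [add_comm k 1, poch_add]
  simp [poch]

lemma poch_ne_zero_iff {x : ℂ} {k : ℕ} : poch x k ≠ 0 ↔ ∀ l < k, x + (l : ℂ) ≠ 0 := by
  simp [poch, Finset.prod_ne_zero_iff]

lemma poch_ne_zero_of_le {x : ℂ} {i k : ℕ} (h : poch x k ≠ 0) (hik : i ≤ k) : poch x i ≠ 0 :=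
  poch_ne_zero_iff.2 fun l hl => poch_ne_zero_iff.1 h l (hl.trans_le hik)

lemma poch_neg_of_lt {m k : ℕ} (h : m < k) : poch (-(m : ℂ)) k = 0 :=
  Finset.prod_eq_zero (Finset.mem_range.2 h) (by simp)

lemma poch_one (k : ℕ) : poch 1 k = (k.factorial : ℂ) := by
  induction k with
  | zero => simp
  | succ k ih => rw [poch_succ, ih, Nat.factorial_succ]; push_cast; ring

lemma poch_reflect (x : ℂ) (k : ℕ) : poch (1 - x - k) k = (-1) ^ k * poch x k := by
  have h : (-1 : ℂ) ^ k = ∏ _l ∈ Finset.range k, (-1 : ℂ) := by simp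
  rw [poch, ← Finset.prod_range_reflect, poch, h, ← Finset.prod_mul_distrib]
  refine Finset.prod_congr rfl fun l hl => ?_
  have : l + 1 ≤ k := Finset.mem_range.1 hl
  rw [Nat.sub_sub, Nat.cast_sub (by omega)]
  push_cast
  ring

/-- Reversal of a shifted factorial. -/
lemma poch_sub_mul (x : ℂ) {i n : ℕ} (h : i ≤ n) :
    poch x (n - i) * poch (1 - x - n) i = (-1) ^ i * poch x n := by
  obtain ⟨m, rfl⟩ := Nat.exists_eq_add_of_le h
  rw [Nat.add_sub_cancel_left, add_comm i m, poch_add]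
  have := poch_reflect (x + m) i
  rw [show 1 - x - ((m + i : ℕ) : ℂ) = 1 - (x + m) - i by push_cast; ring, this]
  ring

lemma poch_eq_smeval (x : ℂ) (k : ℕ) : poch x k = (ascPochhammer ℕ k).smeval x := by
  rw [Polynomial.ascPochhammer_smeval_eq_eval]
  induction k with
  | zero => simp
  | succ k ih => rw [poch_succ, ih, ascPochhammer_succ_eval]

lemma poch_neg (x : ℂ) (k : ℕ) :
    poch (-x) k = (-1) ^ k * (k.factorial * Ring.choose x k) := by
  rw [poch_eq_smeval, Polynomial.ascPochhammer_smeval_neg_eq_descPochhammer,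
    Ring.descPochhammer_eq_factorial_smul_choose]
  simp [Int.negOnePow, zsmul_eq_mul, nsmul_eq_mul, Units.smul_def]

lemma poch_neg_nat (m k : ℕ) :
    poch (-(m : ℂ)) k = (-1) ^ k * (k.factorial * (m.choose k : ℂ)) := by
  rw [poch_neg, Ring.choose_natCast]

/-- Shifted factorials as generalized binomial coefficients; the upper argument `x + k - 1` is left
to the caller, in whatever form it occurs. -/
lemma poch_eq_choose {x y : ℂ} {k : ℕ} (h : y = x + k - 1) :
    poch x k = k.factorial * Ring.choose y k := by
  have h1 := poch_reflect (-y) k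
  rw [poch_neg, show 1 - -y - k = x by rw [h]; ring] at h1
  rw [h1, ← mul_assoc, ← mul_pow]
  simp

lemma poch_eq_choose_nat {x : ℂ} {m k : ℕ} (h : (m : ℂ) = x + k - 1) :
    poch x k = k.factorial * (m.choose k : ℂ) := by
  rw [poch_eq_choose h, Ring.choose_natCast]

lemma poch_eq_choose_neg {x y : ℂ} {k : ℕ} (h : y = -x) :
    poch x k = (-1) ^ k * (k.factorial * Ring.choose y k) := by
  rw [← poch_neg, h, neg_neg]

lemma poch_eq_choose_neg_nat {x : ℂ} {m k : ℕ} (h : (m : ℂ) = -x) :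
    poch x k = (-1) ^ k * (k.factorial * (m.choose k : ℂ)) := by
  rw [← poch_neg_nat, h, neg_neg]

lemma natCast_factorial_ne_zero (k : ℕ) : (k.factorial : ℂ) ≠ 0 :=
  Nat.cast_ne_zero.2 k.factorial_ne_zero

/-! ### Saalschütz summation and expansions of well-poised factors -/

/-- Telescoping in `j` of the difference of two consecutive instances of the Saalschütz sum. -/
lemma saalschutz_telescope (a u v : ℂ) (k J : ℕ) (hu : poch u (J + 1) ≠ 0)
    (hv : poch v (J + 1) ≠ 0) :
    ∑ j ∈ Finset.range (J + 1),
      ((u + k) * (v + k) * (poch (-((k : ℂ) + 1)) j * poch (a + k + 1) j) -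
        (1 + a - u + k) * (1 + a - v + k) * (poch (-(k : ℂ)) j * poch (a + k) j)) *
        (poch (u + v - a - 1) j / (j.factorial * poch u j * poch v j)) =
      (1 + a + 2 * k) * (poch (-(k : ℂ)) J * poch (a + k + 1) J *
        poch (u + v - a - 1) (J + 1) / (J.factorial * poch u J * poch v J)) := by
  induction J with
  | zero => simp [poch_succ]; ring
  | succ J ih =>
    have hu' := poch_ne_zero_of_le hu (Nat.le_succ (J + 1))
    have hv' := poch_ne_zero_of_le hv (Nat.le_succ (J + 1))
    rw [Finset.sum_range_succ, ih hu' hv']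
    have e1 : poch (-((k : ℂ) + 1)) (J + 1) = -((k : ℂ) + 1) * poch (-(k : ℂ)) J := by
      rw [poch_succ_left]; congr 2; ring
    have e2 : poch (a + k) (J + 1) = (a + k) * poch (a + k + 1) J := poch_succ_left _ _
    rw [e1, e2, poch_succ (u + v - a - 1) (J + 1), poch_succ (-(k : ℂ)) J,
      poch_succ (a + k + 1) J, Nat.factorial_succ]
    rw [poch_succ] at hu' hv'
    rw [poch_succ u J, poch_succ v J]
    have h1 := left_ne_zero_of_mul hu'
    have h2 := right_ne_zero_of_mul hu'
    have h3 := left_ne_zero_of_mul hv'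
    have h4 := right_ne_zero_of_mul hv'
    have h5 := natCast_factorial_ne_zero J
    have h6 : (J : ℂ) + 1 ≠ 0 := Nat.cast_add_one_ne_zero J
    push_cast
    field_simp
    ring

/-- The Saalschütz summation, in the form used for well-poised series. -/
lemma saalschutz (a b c : ℂ) (k : ℕ) (hu : poch (1 + a - b) k ≠ 0) (hv : poch (1 + a - c) k ≠ 0) :
    ∑ j ∈ Finset.range (k + 1), poch (-(k : ℂ)) j * poch (a + k) j *
        (poch (1 + a - b - c) j / (j.factorial * poch (1 + a - b) j * poch (1 + a - c) j)) =
      poch b k * poch c k / (poch (1 + a - b) k * poch (1 + a - c) k) := by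
  induction k with
  | zero => simp
  | succ k ih =>
    have hu' := poch_ne_zero_of_le hu (Nat.le_succ k)
    have hv' := poch_ne_zero_of_le hv (Nat.le_succ k)
    have ih := ih hu' hv'
    have tel := saalschutz_telescope a (1 + a - b) (1 + a - c) k k hu hv
    rw [poch_succ] at hu hv
    have h2 := right_ne_zero_of_mul hu
    have h4 := right_ne_zero_of_mul hv
    have eB : 1 + a - b + (1 + a - c) - a - 1 = 1 + a - b - c := by ring
    rw [eB, show 1 + a - (1 + a - b) = b by ring, show 1 + a - (1 + a - c) = c by ring] at tel
    have split : ∀ j, ((1 + a - b + k) * (1 + a - c + k) *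
        (poch (-((k : ℂ) + 1)) j * poch (a + k + 1) j) -
          (b + k) * (c + k) * (poch (-(k : ℂ)) j * poch (a + k) j)) *
        (poch (1 + a - b - c) j / (j.factorial * poch (1 + a - b) j * poch (1 + a - c) j)) =
        (1 + a - b + k) * (1 + a - c + k) * (poch (-((k : ℂ) + 1)) j * poch (a + k + 1) j *
        (poch (1 + a - b - c) j / (j.factorial * poch (1 + a - b) j * poch (1 + a - c) j))) -
        (b + k) * (c + k) * (poch (-(k : ℂ)) j * poch (a + k) j *
        (poch (1 + a - b - c) j / (j.factorial * poch (1 + a - b) j * poch (1 + a - c) j))) := by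
      intro j; ring
    rw [Finset.sum_congr rfl fun j _ => split j, Finset.sum_sub_distrib, ← Finset.mul_sum,
      ← Finset.mul_sum, ih] at tel
    rw [Finset.sum_range_succ]
    push_cast
    rw [show a + ((k : ℂ) + 1) = a + k + 1 by ring]
    have e1 : poch (-((k : ℂ) + 1)) (k + 1) = -((k : ℂ) + 1) * poch (-(k : ℂ)) k := by
      rw [poch_succ_left]; congr 2; ring
    have h5 := natCast_factorial_ne_zero k
    have h6 : (k : ℂ) + 1 ≠ 0 := Nat.cast_add_one_ne_zero k
    rw [sub_eq_iff_eq_add] at tel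
    have key : ∑ x ∈ Finset.range (k + 1), poch (-((k : ℂ) + 1)) x * poch (a + k + 1) x *
        (poch (1 + a - b - c) x / (x.factorial * poch (1 + a - b) x * poch (1 + a - c) x)) =
        (((1 + a + 2 * k) * (poch (-(k : ℂ)) k * poch (a + k + 1) k *
          poch (1 + a - b - c) (k + 1) / (k.factorial * poch (1 + a - b) k * poch (1 + a - c) k))) +
          (b + k) * (c + k) * (poch b k * poch c k / (poch (1 + a - b) k * poch (1 + a - c) k))) /
          ((1 + a - b + k) * (1 + a - c + k)) := by
      rw [eq_div_iff (mul_ne_zero h2 h4), mul_comm, tel]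
    rw [key, e1, poch_succ b, poch_succ c, poch_succ (1 + a - b), poch_succ (1 + a - c),
      poch_succ (a + k + 1), Nat.factorial_succ]
    push_cast
    field_simp
    ring

/-- Coefficients of `(b)_k (c)_k / ((1 + a - b)_k (1 + a - c)_k) * f k` in the basis
`(-k)_i (a + k)_i` when `h` are the coefficients of `f`. -/
noncomputable def baileyStep (a b c : ℂ) (h : ℕ → ℂ) (i : ℕ) : ℂ :=
  ∑ j ∈ Finset.range (i + 1), poch b j * poch c j * poch (1 + a - b - c) (i - j) /
    ((i - j).factorial * poch (1 + a - b) i * poch (1 + a - c) i) * h j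

/-- The function of `k` with coefficients `h` in the basis `(-k)_i (a + k)_i`. -/
noncomputable def baileySum (a : ℂ) (h : ℕ → ℂ) (k : ℕ) : ℂ :=
  ∑ i ∈ Finset.range (k + 1), poch (-(k : ℂ)) i * poch (a + k) i * h i

/-- The factor `(b)_k (c)_k / ((1 + a - b)_k (1 + a - c)_k)` of a well-poised series. -/
noncomputable def pairRatio (a b c : ℂ) (k : ℕ) : ℂ :=
  poch b k * poch c k / (poch (1 + a - b) k * poch (1 + a - c) k)

/-- The Bailey lemma for expansions: multiplication by `pairRatio a b c` is `baileyStep a b c` on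
coefficients. -/
lemma pairRatio_mul_baileySum (a b c : ℂ) (h : ℕ → ℂ) (k : ℕ) (hu : poch (1 + a - b) k ≠ 0)
    (hv : poch (1 + a - c) k ≠ 0) :
    pairRatio a b c k * baileySum a h k = baileySum a (baileyStep a b c h) k := by
  have flip := Finset.sum_range_diag_flip (k + 1) fun j m =>
    poch (-(k : ℂ)) (j + m) * poch (a + k) (j + m) *
      (poch b j * poch c j * poch (1 + a - b - c) m /
        (m.factorial * poch (1 + a - b) (j + m) * poch (1 + a - c) (j + m)) * h j)
  have rhs : baileySum a (baileyStep a b c h) k = ∑ i ∈ Finset.range (k + 1),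
      ∑ j ∈ Finset.range (i + 1), poch (-(k : ℂ)) (j + (i - j)) * poch (a + k) (j + (i - j)) *
      (poch b j * poch c j * poch (1 + a - b - c) (i - j) /
        ((i - j).factorial * poch (1 + a - b) (j + (i - j)) * poch (1 + a - c) (j + (i - j)))
          * h j) := by
    refine Finset.sum_congr rfl fun i _ => ?_
    rw [baileyStep, Finset.mul_sum]
    refine Finset.sum_congr rfl fun j hj => ?_
    rw [Nat.add_sub_cancel' (Nat.lt_succ_iff.1 (Finset.mem_range.1 hj))]
  rw [rhs, flip, baileySum, Finset.mul_sum]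
  refine Finset.sum_congr rfl fun j hj => ?_
  obtain ⟨m, rfl⟩ := Nat.exists_eq_add_of_le (Nat.lt_succ_iff.1 (Finset.mem_range.1 hj))
  rw [show j + m + 1 - j = m + 1 by omega]
  rw [poch_add] at hu hv
  have h1 := left_ne_zero_of_mul hu
  have h2 := right_ne_zero_of_mul hu
  have h3 := left_ne_zero_of_mul hv
  have h4 := right_ne_zero_of_mul hv
  -- the inner sum is the Saalschütz sum with `a`, `b`, `c`, `k` shifted by `2j`, `j`, `j`, `-j`
  have sz := saalschutz (a + 2 * j) (b + j) (c + j) m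
    (by rwa [show 1 + (a + 2 * j) - (b + j) = 1 + a - b + j by ring])
    (by rwa [show 1 + (a + 2 * j) - (c + j) = 1 + a - c + j by ring])
  rw [show 1 + (a + 2 * (j : ℂ)) - (b + j) = 1 + a - b + j by ring,
    show 1 + (a + 2 * (j : ℂ)) - (c + j) = 1 + a - c + j by ring,
    show 1 + a - b + (j : ℂ) - (c + j) = 1 + a - b - c by ring] at sz
  have term : ∀ x, poch (-((j + m : ℕ) : ℂ)) (j + x) * poch (a + (j + m : ℕ)) (j + x) *
      (poch b j * poch c j * poch (1 + a - b - c) x /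
        (x.factorial * poch (1 + a - b) (j + x) * poch (1 + a - c) (j + x)) * h j) =
      poch (-((j + m : ℕ) : ℂ)) j * poch (a + (j + m : ℕ)) j * h j *
      (poch b j * poch c j / (poch (1 + a - b) j * poch (1 + a - c) j)) *
      (poch (-(m : ℂ)) x * poch (a + 2 * j + m) x *
        (poch (1 + a - b - c) x / (x.factorial * poch (1 + a - b + j) x *
          poch (1 + a - c + j) x))) := by
    intro x
    rw [poch_add _ j x, poch_add _ j x, poch_add _ j x, poch_add _ j x,
      show -((j + m : ℕ) : ℂ) + j = -(m : ℂ) by push_cast; ring,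
      show a + ((j + m : ℕ) : ℂ) + j = a + 2 * j + m by push_cast; ring]
    simp only [div_eq_mul_inv, mul_inv]
    ring
  rw [Finset.sum_congr rfl fun x _ => term x, ← Finset.mul_sum, sz, pairRatio,
    poch_add b, poch_add c, poch_add (1 + a - b), poch_add (1 + a - c)]
  simp only [div_eq_mul_inv, mul_inv]
  ring

/-- The weight of the terminating very-well-poised series with parameter `a`, up to the constant
factor `a`. -/
noncomputable def vwpWeight (a : ℂ) (N k : ℕ) : ℂ :=
  poch a k * (a + 2 * k) * poch (-(N : ℂ)) k / (k.factorial * poch (1 + a + N) k)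

/-- The partial sums of the very-well-poised weight are products. -/
lemma sum_vwpWeight_partial (a : ℂ) (N M : ℕ) (h : poch (1 + a + N) M ≠ 0) :
    ∑ k ∈ Finset.range (M + 1), vwpWeight a N k =
      a * poch (a + 1) M * poch (1 - N) M / (M.factorial * poch (1 + a + N) M) := by
  induction M with
  | zero => simp [vwpWeight]
  | succ M ih =>
    rw [Finset.sum_range_succ, ih (poch_ne_zero_of_le h (Nat.le_succ M)), vwpWeight,
      poch_succ_left a, poch_succ_left (-(N : ℂ)), poch_succ (a + 1), poch_succ (1 - (N : ℂ)),
      Nat.factorial_succ, show -(N : ℂ) + 1 = 1 - N by ring]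
    rw [poch_succ] at h ⊢
    have h2 := left_ne_zero_of_mul h
    have h3 := right_ne_zero_of_mul h
    have h5 := natCast_factorial_ne_zero M
    have h6 : (M : ℂ) + 1 ≠ 0 := Nat.cast_add_one_ne_zero M
    push_cast
    field_simp
    ring

lemma sum_vwpWeight_eq_zero (a : ℂ) {N : ℕ} (hN : 0 < N) (h : poch (1 + a + N) N ≠ 0) :
    ∑ k ∈ Finset.range (N + 1), vwpWeight a N k = 0 := by
  obtain ⟨m, rfl⟩ := Nat.exists_eq_succ_of_ne_zero hN.ne'
  rw [sum_vwpWeight_partial a _ _ h, show (1 : ℂ) - ((m + 1 : ℕ) : ℂ) = -(m : ℂ) by push_cast; ring,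
    poch_neg_of_lt (Nat.lt_succ_self m)]
  simp

/-- Multiplication by the `l`-th basis function shifts the parameter of the very-well-poised weight
by `2l` and its length by `-l`, up to a constant. -/
lemma vwpWeight_shift (a : ℂ) (l p m : ℕ) (h : poch (1 + a + (l + p : ℕ)) (l + m) ≠ 0) :
    vwpWeight a (l + p) (l + m) * (poch (-((l + m : ℕ) : ℂ)) l * poch (a + (l + m : ℕ)) l) =
      (-1) ^ l * poch a (2 * l) * poch (-((l + p : ℕ) : ℂ)) l / poch (1 + a + (l + p : ℕ)) l *
        vwpWeight (a + 2 * l) p m := by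
  have e1 : poch a (l + m) * poch (a + (l + m : ℕ)) l = poch a (2 * l) * poch (a + 2 * l) m := by
    rw [← poch_add]
    have := poch_add a (2 * l) m
    push_cast at this
    rw [← this]; congr 1; ring
  have e2 : poch (-((l + m : ℕ) : ℂ)) l * m.factorial = (-1) ^ l * (l + m).factorial := by
    have h0 := poch_sub_mul 1 (Nat.le_add_right l m)
    rw [Nat.add_sub_cancel_left, poch_one, poch_one,
      show (1 : ℂ) - 1 - ((l + m : ℕ) : ℂ) = -((l + m : ℕ) : ℂ) by ring] at h0
    rw [mul_comm, h0]
  have e3 : poch (-((l + p : ℕ) : ℂ)) (l + m) =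
      poch (-((l + p : ℕ) : ℂ)) l * poch (-(p : ℂ)) m := by
    rw [poch_add]; congr 2; push_cast; ring
  have e4 : poch (1 + a + (l + p : ℕ)) (l + m) =
      poch (1 + a + (l + p : ℕ)) l * poch (1 + (a + 2 * l) + p) m := by
    rw [poch_add]; congr 2; push_cast; ring
  rw [e4] at h
  have h2 := left_ne_zero_of_mul h
  have h3 := right_ne_zero_of_mul h
  have h5 := natCast_factorial_ne_zero m
  have h6 := natCast_factorial_ne_zero (l + m)
  rw [vwpWeight, vwpWeight, e3, e4]
  have e5 : poch (-((l + m : ℕ) : ℂ)) l = (-1) ^ l * (l + m).factorial / m.factorial := by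
    rw [eq_div_iff h5, e2]
  calc _ = (poch a (l + m) * poch (a + (l + m : ℕ)) l) * (a + 2 * (l + m : ℕ)) *
        (poch (-((l + p : ℕ) : ℂ)) l * poch (-(p : ℂ)) m) /
        ((l + m).factorial * (poch (1 + a + (l + p : ℕ)) l * poch (1 + (a + 2 * l) + p) m)) *
        poch (-((l + m : ℕ) : ℂ)) l := by ring
    _ = _ := by
      rw [e1, e5]
      generalize poch a (2 * l) = A
      push_cast at *
      field_simp
      ring

/-- Against the very-well-poised weight, all basis functions `(-k)_l (a + k)_l` with `l < N` sum to
zero, and the sum for `l = N` consists of one term. -/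
lemma sum_vwpWeight_mul_basis (a : ℂ) {N l : ℕ} (hl : l ≤ N) (h : poch (1 + a + N) N ≠ 0) :
    ∑ k ∈ Finset.range (N + 1), vwpWeight a N k * (poch (-(k : ℂ)) l * poch (a + k) l) =
      if l = N then poch a (N + 1) * N.factorial else 0 := by
  obtain ⟨p, rfl⟩ := Nat.exists_eq_add_of_le hl
  rw [add_assoc, Finset.sum_range_add, Finset.sum_eq_zero, zero_add]
  swap
  · intro k hk
    rw [poch_neg_of_lt (Finset.mem_range.1 hk)]; ring
  have hs : ∀ m ∈ Finset.range (p + 1), vwpWeight a (l + p) (l + m) *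
      (poch (-((l + m : ℕ) : ℂ)) l * poch (a + (l + m : ℕ)) l) =
      (-1) ^ l * poch a (2 * l) * poch (-((l + p : ℕ) : ℂ)) l / poch (1 + a + (l + p : ℕ)) l *
        vwpWeight (a + 2 * l) p m := fun m hm =>
    vwpWeight_shift a l p m (poch_ne_zero_of_le h (by have := Finset.mem_range.1 hm; omega))
  rw [Finset.sum_congr rfl hs, ← Finset.mul_sum]
  have hd : poch (1 + a + (l + p : ℕ)) (l + p) =
      poch (1 + a + (l + p : ℕ)) l * poch (1 + (a + 2 * l) + p) p := by
    rw [poch_add]; congr 2; push_cast; ring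
  rcases Nat.eq_zero_or_pos p with rfl | hp
  · have e2 : poch (-(l : ℂ)) l = (-1) ^ l * l.factorial := by
      rw [poch_neg_nat, Nat.choose_self]; simp
    have e3 : poch a (2 * l) * (a + 2 * l) = poch a (l + 1) * poch (1 + a + l) l := by
      rw [show a + 2 * (l : ℂ) = a + (2 * l : ℕ) by push_cast; ring, ← poch_succ,
        show 1 + a + (l : ℂ) = a + (l + 1 : ℕ) by push_cast; ring, ← poch_add]
      congr 1; ring
    simp only [add_zero] at h ⊢
    simp only [zero_add, Finset.sum_range_one, vwpWeight, poch_zero, if_true, e2,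
      Nat.factorial_zero, Nat.cast_one, Nat.cast_zero, mul_zero, add_zero, mul_one, one_mul,
      div_one]
    rw [div_mul_eq_mul_div, div_eq_iff h]
    have : ((-1 : ℂ) ^ l) * (-1) ^ l = 1 := by rw [← mul_pow]; simp
    linear_combination (l.factorial : ℂ) * e3 +
      (poch a (2 * l) * (a + 2 * l) * l.factorial) * this
  · rw [if_neg (by omega), sum_vwpWeight_eq_zero _ hp
        (by rw [hd] at h; exact right_ne_zero_of_mul h),
      mul_zero]

lemma sum_vwpWeight_mul_baileySum (a : ℂ) (N : ℕ) (g : ℕ → ℂ) (h : poch (1 + a + N) N ≠ 0) :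
    ∑ k ∈ Finset.range (N + 1), vwpWeight a N k * baileySum a g k =
      poch a (N + 1) * N.factorial * g N := by
  have ext : ∀ k ∈ Finset.range (N + 1), vwpWeight a N k * baileySum a g k =
      ∑ l ∈ Finset.range (N + 1),
        vwpWeight a N k * (poch (-(k : ℂ)) l * poch (a + k) l) * g l := by
    intro k hk
    rw [baileySum, Finset.mul_sum]
    rw [← Finset.sum_subset (Finset.range_subset_range.2 (Finset.mem_range.1 hk))]
    · exact Finset.sum_congr rfl fun l _ => by ring
    · intro l _ hl
      rw [poch_neg_of_lt (by simpa using hl)]; ring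
  rw [Finset.sum_congr rfl ext, Finset.sum_comm]
  rw [Finset.sum_congr rfl fun l hl => by
    rw [← Finset.sum_mul, sum_vwpWeight_mul_basis a (Nat.lt_succ_iff.1 (Finset.mem_range.1 hl)) h]]
  simp [ite_mul]

/-! ### The very-well-poised series and its derivative at `a = -n` -/

/-- `f` has logarithmic derivative `L` at `x`, in a form that does not divide by `f x`. -/
def HasLogDerivAt (f : ℂ → ℂ) (L x : ℂ) : Prop := HasDerivAt f (f x * L) x

lemma HasLogDerivAt.mul {f g : ℂ → ℂ} {L M x : ℂ} (hf : HasLogDerivAt f L x)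
    (hg : HasLogDerivAt g M x) : HasLogDerivAt (fun y => f y * g y) (L + M) x := by
  refine (HasDerivAt.fun_mul hf hg).congr_deriv ?_
  dsimp only
  ring

lemma HasLogDerivAt.inv {f : ℂ → ℂ} {L x : ℂ} (hf : HasLogDerivAt f L x) (h0 : f x ≠ 0) :
    HasLogDerivAt (fun y => (f y)⁻¹) (-L) x := by
  refine (HasDerivAt.fun_inv hf h0).congr_deriv ?_
  dsimp only
  field_simp

lemma hasLogDerivAt_const (c x : ℂ) : HasLogDerivAt (fun _ => c) 0 x := by
  unfold HasLogDerivAt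
  simpa using hasDerivAt_const x c

lemma HasLogDerivAt.prod {ι : Type*} (s : Finset ι) {f : ι → ℂ → ℂ} {L : ι → ℂ} {x : ℂ}
    (h : ∀ i ∈ s, HasLogDerivAt (f i) (L i) x) :
    HasLogDerivAt (fun y => ∏ i ∈ s, f i y) (∑ i ∈ s, L i) x := by
  classical
  induction s using Finset.induction_on with
  | empty => simpa using hasLogDerivAt_const 1 x
  | insert i s hi ih =>
    simp only [Finset.prod_insert hi, Finset.sum_insert hi]
    exact (h i (Finset.mem_insert_self i s)).mul
      (ih fun j hj => h j (Finset.mem_insert_of_mem hj))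

lemma hasLogDerivAt_poch (c x : ℂ) (k : ℕ) (h : poch (c + x) k ≠ 0) :
    HasLogDerivAt (fun y => poch (c + y) k) (∑ l ∈ Finset.range k, (c + x + l)⁻¹) x := by
  refine HasLogDerivAt.prod _ fun l hl => ?_
  have h0 := poch_ne_zero_iff.1 h l (Finset.mem_range.1 hl)
  unfold HasLogDerivAt
  rw [mul_inv_cancel₀ h0]
  exact ((hasDerivAt_id x).const_add c).add_const _

/-- The derivative at a zero of a product only needs continuity of the second factor. -/
lemma hasDerivAt_sub_mul {g : ℂ → ℂ} {c : ℂ} (hg : ContinuousAt g c) :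
    HasDerivAt (fun x => (x - c) * g x) (g c) c := by
  rw [hasDerivAt_iff_tendsto_slope]
  refine (hg.tendsto.mono_left nhdsWithin_le_nhds).congr' ?_
  filter_upwards [self_mem_nhdsWithin] with x hx
  have : x - c ≠ 0 := sub_ne_zero.2 hx
  simp [slope_def_field, this]

@[fun_prop]
lemma continuous_poch (k : ℕ) : Continuous fun x : ℂ => poch x k := by
  unfold poch
  fun_prop

lemma ContinuousAt.poch {X : Type*} [TopologicalSpace X] {f : X → ℂ} {x : X}
    (hf : ContinuousAt f x) (k : ℕ) : ContinuousAt (fun y => poch (f y) k) x :=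
  (continuous_poch k).continuousAt.comp hf

lemma continuousAt_baileyStep {b c x : ℂ} {i : ℕ} {h : ℂ → ℕ → ℂ}
    (hh : ∀ j ≤ i, ContinuousAt (fun a => h a j) x) (hb : poch (1 + x - b) i ≠ 0)
    (hc : poch (1 + x - c) i ≠ 0) : ContinuousAt (fun a => baileyStep a b c (h a) i) x := by
  unfold baileyStep
  refine tendsto_finsetSum _ fun j hj => ?_
  refine ContinuousAt.mul (ContinuousAt.div ?_ ?_ ?_)
    (hh j (Nat.lt_succ_iff.1 (Finset.mem_range.1 hj)))
  · exact continuousAt_const.mul (ContinuousAt.poch (by fun_prop) _)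
  · exact (continuousAt_const.mul (ContinuousAt.poch (by fun_prop) _)).mul
      (ContinuousAt.poch (by fun_prop) _)
  · exact mul_ne_zero (mul_ne_zero (natCast_factorial_ne_zero _) hb) hc

/-- The coefficient sequence of the product of the three factors `pairRatio`. -/
noncomputable def tripleCoeff (a : ℂ) (T : Fin 6 → ℂ) : ℕ → ℂ :=
  baileyStep a (T 4) (T 5) (baileyStep a (T 2) (T 3) fun j =>
    poch (1 + a - T 0 - T 1) j / (j.factorial * poch (1 + a - T 0) j * poch (1 + a - T 1) j))

/-- Andrews' transformation of a terminating very-well-poised series with three pairs of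
parameters. -/
lemma sum_vwpWeight_mul_triple (a : ℂ) (n : ℕ) (T : Fin 6 → ℂ)
    (hT : ∀ s, poch (1 + a - T s) n ≠ 0) (h : poch (1 + a + n) n ≠ 0) :
    ∑ k ∈ Finset.range (n + 1), vwpWeight a n k * (pairRatio a (T 4) (T 5) k *
      (pairRatio a (T 2) (T 3) k * pairRatio a (T 0) (T 1) k)) =
      poch a (n + 1) * n.factorial * tripleCoeff a T n := by
  rw [← sum_vwpWeight_mul_baileySum a n _ h]
  refine Finset.sum_congr rfl fun k hk => ?_
  have hT' : ∀ s, poch (1 + a - T s) k ≠ 0 := fun s =>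
    poch_ne_zero_of_le (hT s) (Nat.lt_succ_iff.1 (Finset.mem_range.1 hk))
  rw [tripleCoeff, ← pairRatio_mul_baileySum _ _ _ _ _ (hT' 4) (hT' 5),
    ← pairRatio_mul_baileySum _ _ _ _ _ (hT' 2) (hT' 3), baileySum,
    saalschutz _ _ _ _ (hT' 0) (hT' 1), ← pairRatio]

/-- The harmonic sum as a function of complex parameters `T`: for `T_s = -n - P_s` the inner sum is
`H_{k+P_s} - H_{P_s}`, and for `T_s = 1 + P_s` it is `H_{n+P_s-k} - H_{n+P_s}`. -/
noncomputable def wellPoisedSum (n : ℕ) (T : Fin 6 → ℂ) : ℂ :=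
  ∑ k ∈ Finset.range (n + 1), (n.choose k : ℂ) ^ 2 *
    (∏ s, poch (T s) k / poch (1 - n - T s) k) *
    (1 + ((n : ℂ) - 2 * k) * (2 * ((harmonic k : ℚ) : ℂ) +
      ∑ s, ∑ l ∈ Finset.range k, (1 - n - T s + l)⁻¹))

/-- Each factor of a well-poised series at `a = -n` is invariant under `k ↦ n - k` up to the sign
`(-1) ^ n`, which disappears in a product of six factors. -/
lemma poch_div_reflect (x : ℂ) {n k : ℕ} (hk : k ≤ n) (h : poch (1 - n - x) n ≠ 0) :
    poch x (n - k) / poch (1 - n - x) (n - k) = (-1) ^ n * (poch x k / poch (1 - n - x) k) := by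
  have h1 := poch_sub_mul x hk
  have h2 := poch_sub_mul x (Nat.sub_le n k)
  rw [Nat.sub_sub_self hk] at h2
  rw [show 1 - x - (n : ℂ) = 1 - n - x by ring] at h1 h2
  have e : (-1 : ℂ) ^ n = (-1) ^ k * (-1) ^ (n - k) := by
    rw [← pow_add, Nat.add_sub_cancel' hk]
  have e' : (-1 : ℂ) ^ (n - k) * (-1) ^ (n - k) = 1 := by rw [← mul_pow]; simp
  rw [div_eq_iff (poch_ne_zero_of_le h (Nat.sub_le n k)), mul_assoc, div_mul_eq_mul_div,
    mul_div_assoc', eq_div_iff (poch_ne_zero_of_le h hk), h1, h2, e]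
  linear_combination (-((-1) ^ k * poch x n)) * e'

lemma prod_poch_div_reflect (T : Fin 6 → ℂ) {n k : ℕ} (hk : k ≤ n)
    (h : ∀ s, poch (1 - n - T s) n ≠ 0) :
    ∏ s, poch (T s) (n - k) / poch (1 - n - T s) (n - k) =
      ∏ s, poch (T s) k / poch (1 - n - T s) k := by
  rw [Finset.prod_congr rfl fun s _ => poch_div_reflect (T s) hk (h s),
    Finset.prod_mul_distrib]
  have : ((-1 : ℂ) ^ n) ^ 6 = 1 := by rw [pow_right_comm]; norm_num
  simp [this]

/-- The factor `n - 2k` is odd under `k ↦ n - k`. -/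
lemma sum_odd_eq_zero {n : ℕ} {W : ℕ → ℂ} (hW : ∀ k ≤ n, W (n - k) = W k) :
    ∑ k ∈ Finset.range (n + 1), W k * ((n : ℂ) - 2 * k) = 0 := by
  have h : ∑ k ∈ Finset.range (n + 1), W k * ((n : ℂ) - 2 * k) =
      -∑ k ∈ Finset.range (n + 1), W k * ((n : ℂ) - 2 * k) := by
    conv_lhs => rw [← Finset.sum_range_reflect]
    rw [← Finset.sum_neg_distrib]
    refine Finset.sum_congr rfl fun k hk => ?_
    have hk : k ≤ n := Nat.lt_succ_iff.1 (Finset.mem_range.1 hk)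
    rw [show n + 1 - 1 - k = n - k by omega, hW k hk, Nat.cast_sub hk]
    ring
  exact self_eq_neg.1 h

lemma harmonic_cast (k : ℕ) :
    ((harmonic k : ℚ) : ℂ) = ∑ l ∈ Finset.range k, (1 + (l : ℂ))⁻¹ := by
  simp [harmonic, add_comm]

/-- A block of reciprocals as a difference of harmonic numbers, from below. -/
lemma sum_inv_add (m k : ℕ) : ∑ l ∈ Finset.range k, (1 + (m : ℂ) + l)⁻¹ =
    ((harmonic (k + m) : ℚ) : ℂ) - ((harmonic m : ℚ) : ℂ) := by
  rw [harmonic_cast, harmonic_cast, add_comm k m, Finset.sum_range_add]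
  simp [add_assoc]

/-- A block of reciprocals as a difference of harmonic numbers, from above. -/
lemma sum_inv_sub {m k : ℕ} (h : k ≤ m) : ∑ l ∈ Finset.range k, (-(m : ℂ) + l)⁻¹ =
    ((harmonic (m - k) : ℚ) : ℂ) - ((harmonic m : ℚ) : ℂ) := by
  induction k with
  | zero => simp
  | succ k ih =>
    obtain ⟨p, rfl⟩ := Nat.exists_eq_add_of_le h
    rw [Finset.sum_range_succ, ih (by omega), show k + 1 + p - k = p + 1 by omega,
      Nat.add_sub_cancel_left, harmonic_succ,
      show -((k + 1 + p : ℕ) : ℂ) + k = -(p + 1) by push_cast; ring, inv_neg]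
    push_cast
    ring

/-- The derivative at `a = -n` of the very-well-poised series. -/
lemma hasDerivAt_vwp (n : ℕ) (T : Fin 6 → ℂ) (hT : ∀ s, poch (1 - n - T s) n ≠ 0) :
    HasDerivAt (fun a => ∑ k ∈ Finset.range (n + 1), vwpWeight a n k *
      (pairRatio a (T 4) (T 5) k * (pairRatio a (T 2) (T 3) k * pairRatio a (T 0) (T 1) k)))
      (wellPoisedSum n T) (-(n : ℂ)) := by
  -- the terms without the factor `a + 2k`
  let Q : ℕ → ℂ → ℂ := fun k a => poch (-(n : ℂ)) k / k.factorial * (∏ s, poch (T s) k) *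
    (poch (0 + a) k * (poch (1 + n + a) k)⁻¹ * ∏ s, (poch (1 - T s + a) k)⁻¹)
  let L : ℕ → ℂ := fun k => ∑ l ∈ Finset.range k, (0 + -(n : ℂ) + l)⁻¹ +
    -∑ l ∈ Finset.range k, (1 + (n : ℂ) + -(n : ℂ) + l)⁻¹ +
    ∑ s, -∑ l ∈ Finset.range k, (1 - T s + -(n : ℂ) + l)⁻¹
  have hQ : ∀ k ≤ n, HasDerivAt (Q k) (Q k (-(n : ℂ)) * L k) (-(n : ℂ)) := by
    intro k hk
    have h1 : poch (0 + -(n : ℂ)) k ≠ 0 := by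
      rw [zero_add, poch_neg_nat]
      have : (n.choose k : ℂ) ≠ 0 := Nat.cast_ne_zero.2 (Nat.choose_pos hk).ne'
      exact mul_ne_zero (pow_ne_zero _ (by norm_num))
        (mul_ne_zero (natCast_factorial_ne_zero k) this)
    have h2 : poch (1 + (n : ℂ) + -(n : ℂ)) k ≠ 0 := by
      rw [add_neg_cancel_right, poch_one]; exact natCast_factorial_ne_zero k
    have h3 : ∀ s, poch (1 - T s + -(n : ℂ)) k ≠ 0 := fun s => by
      rw [show 1 - T s + -(n : ℂ) = 1 - n - T s by ring]
      exact poch_ne_zero_of_le (hT s) hk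
    have := (hasLogDerivAt_const (poch (-(n : ℂ)) k / k.factorial * (∏ s, poch (T s) k))
      (-(n : ℂ))).mul (((hasLogDerivAt_poch 0 _ k h1).mul
        ((hasLogDerivAt_poch (1 + n) _ k h2).inv h2)).mul
        (HasLogDerivAt.prod Finset.univ fun s _ =>
          (hasLogDerivAt_poch (1 - T s) _ k (h3 s)).inv (h3 s)))
    rw [zero_add] at this
    exact this
  have hF : (fun a => ∑ k ∈ Finset.range (n + 1), vwpWeight a n k *
      (pairRatio a (T 4) (T 5) k * (pairRatio a (T 2) (T 3) k * pairRatio a (T 0) (T 1) k))) =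
      fun a => ∑ k ∈ Finset.range (n + 1), (a + 2 * k) * Q k a := by
    funext a
    refine Finset.sum_congr rfl fun k _ => ?_
    simp only [Q, vwpWeight, pairRatio, Fin.prod_univ_six, div_eq_mul_inv, mul_inv, zero_add]
    rw [show 1 + (n : ℂ) + a = 1 + a + n by ring, show 1 - T 0 + a = 1 + a - T 0 by ring,
      show 1 - T 1 + a = 1 + a - T 1 by ring, show 1 - T 2 + a = 1 + a - T 2 by ring,
      show 1 - T 3 + a = 1 + a - T 3 by ring, show 1 - T 4 + a = 1 + a - T 4 by ring,
      show 1 - T 5 + a = 1 + a - T 5 by ring]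
    ring
  rw [hF]
  have hD : HasDerivAt (fun a => ∑ k ∈ Finset.range (n + 1), (a + 2 * k) * Q k a)
      (∑ k ∈ Finset.range (n + 1), (1 * Q k (-(n : ℂ)) +
        (-(n : ℂ) + 2 * k) * (Q k (-(n : ℂ)) * L k))) (-(n : ℂ)) :=
    HasDerivAt.fun_sum fun k hk => ((hasDerivAt_id _).add_const _).mul
      (hQ k (Nat.lt_succ_iff.1 (Finset.mem_range.1 hk)))
  convert hD using 1
  have hQv : ∀ k, Q k (-(n : ℂ)) = (n.choose k : ℂ) ^ 2 *
      (∏ s, poch (T s) k / poch (1 - n - T s) k) := by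
    intro k
    have e : ∀ s, 1 - T s + -(n : ℂ) = 1 - n - T s := fun s => by ring
    simp only [Q, zero_add, add_neg_cancel_right, poch_one, e, poch_neg_nat]
    rw [Finset.prod_div_distrib, Finset.prod_inv_distrib]
    have h5 := natCast_factorial_ne_zero k
    have : ((-1 : ℂ) ^ k) ^ 2 = 1 := by rw [pow_right_comm]; norm_num
    field_simp
    rw [this]; ring
  have hodd := sum_odd_eq_zero (n := n) (W := fun k => (n.choose k : ℂ) ^ 2 *
      (∏ s, poch (T s) k / poch (1 - n - T s) k) * (((harmonic n : ℚ) : ℂ) -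
        ((harmonic (n - k) : ℚ) : ℂ) - ((harmonic k : ℚ) : ℂ))) (by
    intro k hk
    simp only [prod_poch_div_reflect T hk hT, Nat.choose_symm hk, Nat.sub_sub_self hk]
    ring)
  rw [← sub_eq_zero, wellPoisedSum, ← Finset.sum_sub_distrib, ← neg_eq_zero,
    ← Finset.sum_neg_distrib, ← hodd]
  refine Finset.sum_congr rfl fun k hk => ?_
  have hk : k ≤ n := Nat.lt_succ_iff.1 (Finset.mem_range.1 hk)
  have e : ∀ s, 1 - T s + -(n : ℂ) = 1 - n - T s := fun s => by ring
  simp only [L, hQv, zero_add, add_neg_cancel_right, e, ← harmonic_cast, sum_inv_sub hk,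
    Finset.sum_neg_distrib]
  ring

lemma Regular.poch_ne_zero {n : ℕ} {T : Fin 6 → ℂ} (h : Regular n T) (s : Fin 6) :
    poch (1 - n - T s) n ≠ 0 := by
  obtain ⟨h4, h5, h⟩ := h
  obtain ⟨-, h2, h3, h⟩ := h n le_rfl
  obtain ⟨-, h0, h1⟩ := h n le_rfl
  fin_cases s <;> assumption

lemma wellPoisedSum_eq_tripleCoeff (n : ℕ) (T : Fin 6 → ℂ)
    (hT : ∀ s, poch (1 - n - T s) n ≠ 0) :
    wellPoisedSum n T = poch (-(n : ℂ)) n * n.factorial * tripleCoeff (-(n : ℂ)) T n := by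
  have e : ∀ s, 1 + -(n : ℂ) - T s = 1 - n - T s := fun s => by ring
  have hT' : ∀ s, ∀ i ≤ n, poch (1 + -(n : ℂ) - T s) i ≠ 0 := fun s i hi => by
    rw [e]; exact poch_ne_zero_of_le (hT s) hi
  have hev : ∀ᶠ a in 𝓝 (-(n : ℂ)), (∀ s, poch (1 + a - T s) n ≠ 0) ∧ poch (1 + a + n) n ≠ 0 := by
    refine Filter.Eventually.and (Filter.eventually_all.2 fun s => ?_) ?_
    · exact ContinuousAt.eventually_ne (ContinuousAt.poch (by fun_prop) n) (hT' s n le_rfl)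
    · refine ContinuousAt.eventually_ne (ContinuousAt.poch (by fun_prop) n) ?_
      rw [neg_add_cancel_right, poch_one]; exact natCast_factorial_ne_zero n
  have hcont : ContinuousAt (fun a => poch a n * n.factorial * tripleCoeff a T n) (-(n : ℂ)) := by
    refine ContinuousAt.mul (ContinuousAt.mul (ContinuousAt.poch continuousAt_id n)
      continuousAt_const) ?_
    refine continuousAt_baileyStep (fun i hi => continuousAt_baileyStep (fun j hj => ?_)
      (hT' 2 i hi) (hT' 3 i hi)) (hT' 4 n le_rfl) (hT' 5 n le_rfl)
    refine ContinuousAt.div (ContinuousAt.poch (by fun_prop) _)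
      ((continuousAt_const.mul (ContinuousAt.poch (by fun_prop) _)).mul
      (ContinuousAt.poch (by fun_prop) _)) ?_
    exact mul_ne_zero (mul_ne_zero (natCast_factorial_ne_zero _) (hT' 0 j (hj.trans hi)))
      (hT' 1 j (hj.trans hi))
  refine (hasDerivAt_vwp n T hT).unique ((hasDerivAt_sub_mul hcont).congr_of_eventuallyEq ?_)
  filter_upwards [hev] with a ha
  rw [sum_vwpWeight_mul_triple a n T ha.1 ha.2, poch_succ]
  ring

/-- `baileyStep` in hypergeometric form, with the shifted factorials of index `i - j` reversed. -/
lemma baileyStep_eq (a b c : ℂ) (h : ℕ → ℂ) (i : ℕ) (h0 : poch (b + c - a - i) i ≠ 0) :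
    baileyStep a b c h i =
      poch (1 + a - b - c) i / (i.factorial * poch (1 + a - b) i * poch (1 + a - c) i) *
      ∑ j ∈ Finset.range (i + 1),
        poch (-(i : ℂ)) j * poch b j * poch c j / poch (b + c - a - i) j * h j := by
  rw [baileyStep, Finset.mul_sum]
  refine Finset.sum_congr rfl fun j hj => ?_
  have hj : j ≤ i := Nat.lt_succ_iff.1 (Finset.mem_range.1 hj)
  have e1 := poch_sub_mul (1 + a - b - c) hj
  rw [show 1 - (1 + a - b - c) - (i : ℂ) = b + c - a - i by ring] at e1
  have e2 := poch_sub_mul 1 hj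
  rw [poch_one, poch_one, show (1 : ℂ) - 1 - i = -(i : ℂ) by ring] at e2
  have h1 := poch_ne_zero_of_le h0 hj
  have f1 := natCast_factorial_ne_zero (i - j)
  have f2 := natCast_factorial_ne_zero i
  have e3 : ((-1 : ℂ) ^ j) * (-1) ^ j = 1 := by rw [← mul_pow]; simp
  have e1' : poch (1 + a - b - c) i = (-1) ^ j * (poch (1 + a - b - c) (i - j) *
      poch (b + c - a - i) j) := by
    rw [e1, ← mul_assoc, e3, one_mul]
  have e2' : poch (-(i : ℂ)) j = (-1) ^ j * i.factorial / (i - j).factorial := by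
    rw [eq_div_iff f1, mul_comm, e2]
  rw [e1', e2']
  simp only [div_eq_mul_inv, mul_inv]
  have c1 : (poch (b + c - a - i) j) * (poch (b + c - a - i) j)⁻¹ = 1 := mul_inv_cancel₀ h1
  have c2 : (i.factorial : ℂ) * (i.factorial : ℂ)⁻¹ = 1 := mul_inv_cancel₀ f2
  generalize (-1 : ℂ) ^ j = σ at *
  generalize poch (b + c - a - i) j = p at *
  generalize p⁻¹ = p' at *
  generalize (i.factorial : ℂ) = q at *
  generalize q⁻¹ = q' at *
  generalize (poch (1 + a - b) i)⁻¹ = u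
  generalize (poch (1 + a - c) i)⁻¹ = v
  calc _ = (poch b j * poch c j * poch (1 + a - b - c) (i - j) *
        (((i - j).factorial : ℂ)⁻¹ * u * v) * h j) * ((σ * σ) * (p * p') * (q * q')) := by
        rw [e3, c1, c2]; ring
    _ = _ := by ring

lemma hypergeom_eq_sum (i : ℕ) (α β γ δ ε ζ : ℂ) :
    hypergeom [-(i : ℂ), α, β, γ] [δ, ε, ζ] 1 = ∑ j ∈ Finset.range (i + 1),
      poch (-(i : ℂ)) j * poch α j * poch β j * poch γ j /
        (j.factorial * poch δ j * poch ε j * poch ζ j) := by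
  rw [hypergeom, tsum_eq_sum (s := Finset.range (i + 1))]
  · refine Finset.sum_congr rfl fun j _ => ?_
    simp [poch_one, mul_assoc]
  · intro k hk
    simp [poch_neg_of_lt (show i < k by simpa using hk)]

/-- Andrews' transformation at the degenerate value `a = -n`, where it is an identity of
derivatives. -/
lemma wellPoisedSum_eq_hyperSide {n : ℕ} {T : Fin 6 → ℂ} (h : Regular n T) :
    wellPoisedSum n T = hyperSide n T := by
  rw [wellPoisedSum_eq_tripleCoeff n T h.poch_ne_zero, tripleCoeff]
  obtain ⟨-, -, h⟩ := h
  have e45 : T 4 + T 5 - -(n : ℂ) - n = T 4 + T 5 := by ring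
  have e : ∀ x : ℂ, 1 + -(n : ℂ) - x = 1 - n - x := fun x => by ring
  rw [baileyStep_eq _ _ _ _ _ (by rw [e45]; exact (h n le_rfl).1), hyperSide, e45, ← mul_assoc]
  simp only [e]
  have f := natCast_factorial_ne_zero n
  congr 1
  · field_simp
  refine Finset.sum_congr rfl fun i hi => ?_
  have hi : i ≤ n := Nat.lt_succ_iff.1 (Finset.mem_range.1 hi)
  obtain ⟨-, -, -, hr⟩ := h i hi
  have e23 : T 2 + T 3 - -(n : ℂ) - i = T 2 + T 3 + n - i := by ring
  rw [baileyStep_eq _ _ _ _ _ (by rw [e23]; exact (hr i le_rfl).1), e23, hypergeom_eq_sum]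
  simp only [e]
  rw [poch_one, ← mul_assoc]
  congr 1
  · simp only [div_eq_mul_inv, mul_inv]
    ring
  · refine Finset.sum_congr rfl fun j _ => ?_
    simp only [div_eq_mul_inv, mul_inv]
    ring

/-! ### The parameters of the harmonic number sums -/

lemma poch_ne_zero_of_int {x : ℂ} {k : ℕ} (m : ℤ) (hx : x = m) (h : ∀ l : ℕ, l < k → m + l ≠ 0) :
    poch x k ≠ 0 :=
  poch_ne_zero_iff.2 fun l hl => by rw [hx]; exact_mod_cast h l hl

lemma eventually_poch_ne_zero (c m d : ℂ) (hm : m ≠ 0) (k : ℕ) :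
    ∀ᶠ x in 𝓝[≠] d, poch (c + m * x) k ≠ 0 := by
  have h : ∀ l ∈ Finset.range k, ∀ᶠ x in 𝓝[≠] d, x ≠ -(c + l) / m := fun l _ => by
    by_cases hd : d = -(c + l) / m
    · rw [← hd]; exact self_mem_nhdsWithin
    · exact eventually_ne_nhdsWithin hd
  filter_upwards [(Finset.eventually_all _).2 h] with x hx
  refine poch_ne_zero_iff.2 fun l hl h0 => hx l (Finset.mem_range.2 hl) ?_
  rw [eq_div_iff hm]
  linear_combination h0

/-- All shifted factorials in `Regular` are initial segments of those occurring here. -/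
lemma regular_of {n : ℕ} {T : Fin 6 → ℂ} (h : ∀ s, poch (1 - n - T s) n ≠ 0)
    (h45 : poch (T 4 + T 5) n ≠ 0) (h23 : ∀ i ≤ n, poch (T 2 + T 3 + n - i) i ≠ 0) :
    Regular n T :=
  ⟨h 4, h 5, fun i hi => ⟨poch_ne_zero_of_le h45 hi, poch_ne_zero_of_le (h 2) hi,
    poch_ne_zero_of_le (h 3) hi, fun _ hj => ⟨poch_ne_zero_of_le (h23 i hi) hj,
    poch_ne_zero_of_le (h 0) (hj.trans hi), poch_ne_zero_of_le (h 1) (hj.trans hi)⟩⟩⟩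

/-- Moving a point along the diagonal makes it regular: no linear form occurring in a denominator
vanishes on the diagonal direction. -/
lemma mem_closure_regular (n : ℕ) (T : Fin 6 → ℂ) : T ∈ closure {T | Regular n T} := by
  have ht : Tendsto (fun (t : ℂ) (s : Fin 6) => T s + t) (𝓝[≠] 0) (𝓝 T) := by
    have : Continuous fun (t : ℂ) (s : Fin 6) => T s + t := by fun_prop
    simpa using (this.tendsto 0).mono_left nhdsWithin_le_nhds
  refine mem_closure_of_tendsto ht ?_
  have h1 : ∀ᶠ t : ℂ in 𝓝[≠] 0, ∀ s, poch (1 - n - T s + -1 * t) n ≠ 0 :=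
    Filter.eventually_all.2 fun s => eventually_poch_ne_zero _ _ _ (by norm_num) _
  have h2 := eventually_poch_ne_zero (T 4 + T 5) 2 0 (by norm_num) n
  have h3 : ∀ᶠ t : ℂ in 𝓝[≠] 0, ∀ i ∈ Finset.range (n + 1),
      poch (T 2 + T 3 + n - i + 2 * t) i ≠ 0 :=
    (Finset.eventually_all _).2 fun i _ => eventually_poch_ne_zero _ _ _ (by norm_num) _
  filter_upwards [h1, h2, h3] with t h1 h2 h3
  refine regular_of (fun s => ?_) ?_ fun i hi => ?_
  · convert h1 s using 2; ring
  · convert h2 using 2; ring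
  · convert h3 i (Finset.mem_range.2 (Nat.lt_succ_of_le hi)) using 2; ring

/-- Unlike the double sum `hyperSide`, the sum `wellPoisedSum` has no denominators other than the
`(1 - n - T_s)_k`. -/
lemma continuousAt_wellPoisedSum {n : ℕ} {T : Fin 6 → ℂ} (h : ∀ s, poch (1 - n - T s) n ≠ 0) :
    ContinuousAt (wellPoisedSum n) T := by
  unfold wellPoisedSum
  refine tendsto_finsetSum _ fun k hk => ?_
  have hk : k ≤ n := Nat.lt_succ_iff.1 (Finset.mem_range.1 hk)
  refine ContinuousAt.mul (ContinuousAt.mul continuousAt_const ?_) (continuousAt_const.add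
    (continuousAt_const.mul (continuousAt_const.add ?_)))
  · refine tendsto_finsetProd _ fun s _ => ContinuousAt.div
      (Continuous.continuousAt (by fun_prop)) (Continuous.continuousAt (by fun_prop))
      (poch_ne_zero_of_le (h s) hk)
  · refine tendsto_finsetSum _ fun s _ => tendsto_finsetSum _ fun l hl => ?_
    exact ContinuousAt.inv₀ (Continuous.continuousAt (by fun_prop)) (poch_ne_zero_iff.1 (h s) l
      ((Finset.mem_range.1 hl).trans_le hk))

lemma poch_one_sub_param_ne_zero (n v : ℕ) (P : Fin 6 → ℕ) (s : Fin 6) :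
    poch (1 - n - param n v P s) n ≠ 0 := by
  unfold param
  split_ifs
  · exact poch_ne_zero_of_int (-n - P s) (by push_cast; ring) fun l hl => by omega
  · exact poch_ne_zero_of_int (1 + P s) (by push_cast; ring) fun l hl => by omega

lemma poch_param_div (n v : ℕ) (P : Fin 6 → ℕ) (s : Fin 6) (k : ℕ) :
    poch (param n v P s) k / poch (1 - n - param n v P s) k =
      (-1) ^ k * if (s : ℕ) < v then ((k + P s).choose k : ℂ) / ((n + P s).choose k : ℂ)
        else ((n + P s).choose k : ℂ) / ((k + P s).choose k : ℂ) := by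
  have h1 : poch (1 + (P s : ℂ)) k = k.factorial * ((k + P s).choose k : ℂ) :=
    poch_eq_choose_nat (by push_cast; ring)
  have h2 : poch (-(n : ℂ) - P s) k = (-1) ^ k * (k.factorial * ((n + P s).choose k : ℂ)) :=
    poch_eq_choose_neg_nat (by push_cast; ring)
  have h3 : (1 : ℂ) - n - (1 + P s) = -(n : ℂ) - P s := by ring
  have h4 : (1 : ℂ) - n - (-n - P s) = 1 + P s := by ring
  have f := natCast_factorial_ne_zero k
  unfold param
  split_ifs
  · rw [h3, h1, h2]
    rcases neg_one_pow_eq_or ℂ k with h | h <;> rw [h] <;> field_simp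
  · rw [h4, h1, h2]
    rcases neg_one_pow_eq_or ℂ k with h | h <;> rw [h] <;> field_simp

lemma sum_inv_param (n v : ℕ) (P : Fin 6 → ℕ) (s : Fin 6) {k : ℕ} (hk : k ≤ n) :
    ∑ l ∈ Finset.range k, (1 - n - param n v P s + l)⁻¹ =
      if (s : ℕ) < v then ((harmonic (n + P s - k) : ℚ) : ℂ) - ((harmonic (n + P s) : ℚ) : ℂ)
      else ((harmonic (k + P s) : ℚ) : ℂ) - ((harmonic (P s) : ℚ) : ℂ) := by
  unfold param
  split_ifs
  · rw [← sum_inv_sub (m := n + P s) (by omega)]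
    refine Finset.sum_congr rfl fun l _ => ?_
    push_cast; congr 1; ring
  · rw [← sum_inv_add]
    refine Finset.sum_congr rfl fun l _ => ?_
    congr 1; ring

/-- For a parameter `1 + P` the reciprocals in `wellPoisedSum` sum to a difference involving
`H_{n+P-k}` and not `H_{k+P}`, hence the two sums do not agree term by term. -/
lemma wellPoisedSum_param (n v : ℕ) (P : Fin 6 → ℕ) :
    wellPoisedSum n (param n v P) = harmonicSum n v P := by
  -- the two sums differ by a sum over terms odd under `k ↦ n - k`
  have hodd := sum_odd_eq_zero (n := n) (W := fun k => (n.choose k : ℂ) ^ 2 *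
      (∏ s, poch (param n v P s) k / poch (1 - n - param n v P s) k) *
      ∑ s : Fin 6, if (s : ℕ) < v then ((harmonic (n + P s - k) : ℚ) : ℂ) +
        ((harmonic (k + P s) : ℚ) : ℂ) - ((harmonic (n + P s) : ℚ) : ℂ)
        else -((harmonic (P s) : ℚ) : ℂ)) (by
    intro k hk
    have e1 : ∀ s, n + P s - (n - k) = k + P s := fun s => by omega
    have e2 : ∀ s, n - k + P s = n + P s - k := fun s => by omega
    simp only [prod_poch_div_reflect _ hk (poch_one_sub_param_ne_zero n v P),
      Nat.choose_symm hk, e1, e2]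
    congr 1
    refine Finset.sum_congr rfl fun s _ => ?_
    split_ifs <;> ring)
  rw [← sub_eq_zero, wellPoisedSum, harmonicSum, ← Finset.sum_sub_distrib, ← hodd]
  refine Finset.sum_congr rfl fun k hk => ?_
  have hk : k ≤ n := Nat.lt_succ_iff.1 (Finset.mem_range.1 hk)
  have hs : ((-1 : ℂ) ^ k) ^ 6 = 1 := by rw [pow_right_comm]; norm_num
  have hp : ∏ s, poch (param n v P s) k / poch (1 - n - param n v P s) k =
      ∏ s : Fin 6, if (s : ℕ) < v then ((k + P s).choose k : ℂ) / ((n + P s).choose k : ℂ)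
        else ((n + P s).choose k : ℂ) / ((k + P s).choose k : ℂ) := by
    rw [Finset.prod_congr rfl fun s _ => poch_param_div n v P s k, Finset.prod_mul_distrib]
    simp [hs]
  have hsum : (∑ s, ∑ l ∈ Finset.range k, (1 - n - param n v P s + l)⁻¹) =
      (∑ s : Fin 6, if (s : ℕ) < v then ((harmonic (n + P s - k) : ℚ) : ℂ) +
        ((harmonic (k + P s) : ℚ) : ℂ) - ((harmonic (n + P s) : ℚ) : ℂ)
        else -((harmonic (P s) : ℚ) : ℂ)) + ∑ s : Fin 6, if (s : ℕ) < v then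
          -((harmonic (k + P s) : ℚ) : ℂ) else ((harmonic (k + P s) : ℚ) : ℂ) := by
    rw [← Finset.sum_add_distrib]
    refine Finset.sum_congr rfl fun s _ => ?_
    rw [sum_inv_param n v P s hk]
    split_ifs <;> ring
  rw [hp, hsum]
  ring

lemma param_eq_intCast (n v : ℕ) (P : Fin 6 → ℕ) (s : Fin 6) :
    param n v P s = ((if (s : ℕ) < v then 1 + (P s : ℤ) else -n - P s : ℤ) : ℂ) := by
  unfold param
  split_ifs <;> push_cast <;> rfl

lemma regular_param {n v : ℕ} {P : Fin 6 → ℕ} (h3 : ¬ (v = 3 ∧ P 3 ≤ P 2 ∧ P 2 < P 3 + n))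
    (h5 : ¬ (v = 5 ∧ P 5 ≤ P 4 ∧ P 4 < P 5 + n)) : Regular n (param n v P) := by
  have e : ((2 : Fin 6) : ℕ) = 2 ∧ ((3 : Fin 6) : ℕ) = 3 ∧ ((4 : Fin 6) : ℕ) = 4 ∧
    ((5 : Fin 6) : ℕ) = 5 := ⟨rfl, rfl, rfl, rfl⟩
  refine regular_of (poch_one_sub_param_ne_zero n v P) ?_ fun i hi => ?_
  · refine poch_ne_zero_of_int _ (by rw [param_eq_intCast, param_eq_intCast, ← Int.cast_add])
      fun l hl => ?_
    split_ifs <;> omega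
  · refine poch_ne_zero_of_int ((if ((2 : Fin 6) : ℕ) < v then 1 + (P 2 : ℤ) else -n - P 2) +
      (if ((3 : Fin 6) : ℕ) < v then 1 + (P 3 : ℤ) else -n - P 3) + n - i)
      (by rw [param_eq_intCast, param_eq_intCast]; push_cast; rfl) fun l hl => ?_
    split_ifs <;> omega

lemma tendsto_hyperSide (n v : ℕ) (P : Fin 6 → ℕ) :
    Tendsto (hyperSide n) (𝓝[{T | Regular n T}] (param n v P)) (𝓝 (harmonicSum n v P)) := by
  rw [← wellPoisedSum_param]
  refine ((continuousAt_wellPoisedSum (poch_one_sub_param_ne_zero n v P)).tendsto.mono_left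
    nhdsWithin_le_nhds).congr' ?_
  filter_upwards [self_mem_nhdsWithin] with T hT
  exact wellPoisedSum_eq_hyperSide hT

/-! ### The double sums in terms of binomial coefficients -/

lemma mul_two_div_mul_two {f : ℂ} (hf : f ≠ 0) (a b c d : ℂ) :
    f * a * (f * b) / (f * c * (f * d)) = a * b / (c * d) := by
  rw [show f * a * (f * b) = f ^ 2 * (a * b) by ring,
    show f * c * (f * d) = f ^ 2 * (c * d) by ring, mul_div_mul_left _ _ (pow_ne_zero 2 hf)]

lemma mul_four_div_mul_four {f : ℂ} (hf : f ≠ 0) (a b c d p q r : ℂ) :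
    f * a * (f * b) * (f * c) * (f * d) / (f * (f * p) * (f * q) * (f * r)) =
      a * b * c * d / (p * q * r) := by
  rw [show f * a * (f * b) * (f * c) * (f * d) = f ^ 4 * (a * b * c * d) by ring,
    show f * (f * p) * (f * q) * (f * r) = f ^ 4 * (p * q * r) by ring,
    mul_div_mul_left _ _ (pow_ne_zero 4 hf)]

lemma poch_eq_sign_choose {x y : ℂ} {k : ℕ} (h : y = -x) :
    poch x k = k.factorial * ((-1) ^ k * Ring.choose y k) := by
  rw [poch_eq_choose_neg h]; ring

lemma poch_eq_sign_choose_nat {x : ℂ} {m k : ℕ} (h : (m : ℂ) = -x) :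
    poch x k = k.factorial * ((-1) ^ k * (m.choose k : ℂ)) := by
  rw [poch_eq_choose_neg_nat h]; ring

lemma poch_neg_self (n : ℕ) : poch (-(n : ℂ)) n = n.factorial * (-1) ^ n := by
  rw [poch_neg_nat, Nat.choose_self]; simp [mul_comm]

/-- The factor in front of the double sum. -/
noncomputable def frontFactor (n : ℕ) (x y : ℂ) : ℂ :=
  poch (-(n : ℂ)) n * poch (1 - n - x - y) n / (poch (1 - n - x) n * poch (1 - n - y) n)

/-- The factor of a term of the outer sum outside the inner sum. -/
noncomputable def outerFactor (n i : ℕ) (x y z w : ℂ) : ℂ :=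
  poch (-(n : ℂ)) i * poch x i * poch y i * poch (1 - n - z - w) i /
    (i.factorial * poch (x + y) i * poch (1 - n - z) i * poch (1 - n - w) i)

/-- A term of the inner sum.

In the lemmas on `frontFactor`, `outerFactor` and `innerTerm`, each of the parameters is of the
first kind, `1 + b`, or of the second kind, `-n - b`, and the names list the kinds in order. -/
noncomputable def innerTerm (n i j : ℕ) (x y z w : ℂ) : ℂ :=
  poch (-(i : ℂ)) j * poch x j * poch y j * poch (1 - n - z - w) j /
    (j.factorial * poch (x + y + n - i) j * poch (1 - n - z) j * poch (1 - n - w) j)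

lemma hyperSide_vec (n : ℕ) (x₀ x₁ x₂ x₃ x₄ x₅ : ℂ) :
    hyperSide n ![x₀, x₁, x₂, x₃, x₄, x₅] = frontFactor n x₄ x₅ *
      ∑ i ∈ Finset.range (n + 1), outerFactor n i x₄ x₅ x₂ x₃ *
        ∑ j ∈ Finset.range (i + 1), innerTerm n i j x₂ x₃ x₀ x₁ := by
  rw [hyperSide]
  refine congrArg₂ _ rfl (Finset.sum_congr rfl fun i _ => congrArg₂ _ ?_ ?_)
  · rw [poch_one]; rfl
  · rw [hypergeom_eq_sum]; rfl

lemma frontFactor_first_first (n b c : ℕ) : frontFactor n (1 + b) (1 + c) =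
    ((1 + b + c + n).choose n : ℂ) / (((n + b).choose n : ℂ) * ((n + c).choose n : ℂ)) := by
  rw [frontFactor, poch_neg_self,
    poch_eq_sign_choose_nat (m := 1 + b + c + n) (x := 1 - n - (1 + b) - (1 + c))
      (by push_cast; ring),
    poch_eq_sign_choose_nat (m := n + b) (by push_cast; ring),
    poch_eq_sign_choose_nat (m := n + c) (by push_cast; ring),
    mul_two_div_mul_two (natCast_factorial_ne_zero n)]
  rcases neg_one_pow_eq_or ℂ n with h | h <;> simp only [h] <;> ring

lemma frontFactor_first_second (n : ℕ) (b : ℂ) (c : ℕ) : frontFactor n (1 + b) (-n - c) =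
    (-1 : ℂ) ^ n * (Ring.choose (b - c) n / (Ring.choose (n + b) n * ((n + c).choose n : ℂ))) := by
  rw [frontFactor, poch_neg_self,
    poch_eq_sign_choose (y := b - c) (x := 1 - n - (1 + b) - (-n - c)) (by ring),
    poch_eq_sign_choose (y := n + b) (by ring),
    poch_eq_choose_nat (m := n + c) (by push_cast; ring),
    mul_two_div_mul_two (natCast_factorial_ne_zero n)]
  rcases neg_one_pow_eq_or ℂ n with h | h <;> simp only [h] <;> ring

lemma frontFactor_second_second (n b c : ℕ) : frontFactor n (-n - b) (-n - c) =
    (-1 : ℂ) ^ n *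
    (((2 * n + b + c).choose n : ℂ) / (((n + b).choose n : ℂ) * ((n + c).choose n : ℂ))) := by
  rw [frontFactor, poch_neg_self,
    poch_eq_choose_nat (m := 2 * n + b + c) (x := 1 - n - (-n - b) - (-n - c))
      (by push_cast; ring),
    poch_eq_choose_nat (m := n + b) (by push_cast; ring),
    poch_eq_choose_nat (m := n + c) (by push_cast; ring),
    mul_two_div_mul_two (natCast_factorial_ne_zero n)]
  ring

lemma outerFactor_first_first_first_first (n i b c d e : ℕ) :
    outerFactor n i (1 + b) (1 + c) (1 + d) (1 + e) = (n.choose i : ℂ) *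
    ((((i + b).choose i : ℂ) * ((i + c).choose i : ℂ) * ((1 + d + e + n).choose i : ℂ)) /
      (((n + d).choose i : ℂ) * ((n + e).choose i : ℂ) * ((1 + b + c + i).choose i : ℂ))) := by
  rw [outerFactor, poch_eq_sign_choose_nat (m := n) (by ring),
    poch_eq_choose_nat (m := i + b) (by push_cast; ring),
    poch_eq_choose_nat (m := i + c) (by push_cast; ring),
    poch_eq_sign_choose_nat (m := 1 + d + e + n) (x := 1 - n - (1 + d) - (1 + e))
      (by push_cast; ring),
    poch_eq_choose_nat (m := 1 + b + c + i) (x := 1 + b + (1 + c)) (by push_cast; ring),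
    poch_eq_sign_choose_nat (m := n + d) (by push_cast; ring),
    poch_eq_sign_choose_nat (m := n + e) (by push_cast; ring),
    mul_four_div_mul_four (natCast_factorial_ne_zero i)]
  rcases neg_one_pow_eq_or ℂ i with h | h <;> simp only [h] <;> ring

lemma outerFactor_first_first_first_second (n i b c : ℕ) (d : ℂ) (e : ℕ) :
    outerFactor n i (1 + b) (1 + c) (1 + d) (-n - e) = (-1 : ℂ) ^ i * (n.choose i : ℂ) *
    ((((i + b).choose i : ℂ) * ((i + c).choose i : ℂ) * Ring.choose (d - e) i) /
      (Ring.choose (n + d) i * ((i + e).choose i : ℂ) * ((1 + b + c + i).choose i : ℂ))) := by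
  rw [outerFactor, poch_eq_sign_choose_nat (m := n) (by ring),
    poch_eq_choose_nat (m := i + b) (by push_cast; ring),
    poch_eq_choose_nat (m := i + c) (by push_cast; ring),
    poch_eq_sign_choose (y := d - e) (x := 1 - n - (1 + d) - (-n - e)) (by ring),
    poch_eq_choose_nat (m := 1 + b + c + i) (x := 1 + b + (1 + c)) (by push_cast; ring),
    poch_eq_sign_choose (y := n + d) (by ring),
    poch_eq_choose_nat (m := i + e) (by push_cast; ring),
    mul_four_div_mul_four (natCast_factorial_ne_zero i)]
  rcases neg_one_pow_eq_or ℂ i with h | h <;> simp only [h] <;> ring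

lemma outerFactor_first_first_second_second (n i b c d e : ℕ) :
    outerFactor n i (1 + b) (1 + c) (-n - d) (-n - e) = (-1 : ℂ) ^ i * (n.choose i : ℂ) *
    ((((i + b).choose i : ℂ) * ((i + c).choose i : ℂ) * ((i + d + e + n).choose i : ℂ)) /
      (((i + d).choose i : ℂ) * ((i + e).choose i : ℂ) * ((i + b + c + 1).choose i : ℂ))) := by
  rw [outerFactor, poch_eq_sign_choose_nat (m := n) (by ring),
    poch_eq_choose_nat (m := i + b) (by push_cast; ring),
    poch_eq_choose_nat (m := i + c) (by push_cast; ring),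
    poch_eq_choose_nat (m := i + d + e + n) (x := 1 - n - (-n - d) - (-n - e))
      (by push_cast; ring),
    poch_eq_choose_nat (m := i + b + c + 1) (x := 1 + b + (1 + c)) (by push_cast; ring),
    poch_eq_choose_nat (m := i + d) (by push_cast; ring),
    poch_eq_choose_nat (m := i + e) (by push_cast; ring),
    mul_four_div_mul_four (natCast_factorial_ne_zero i)]
  ring

lemma outerFactor_first_second_second_second (n i : ℕ) (b : ℂ) (c d e : ℕ) :
    outerFactor n i (1 + b) (-n - c) (-n - d) (-n - e) = (n.choose i : ℂ) *
    ((Ring.choose (i + b) i * ((n + c).choose i : ℂ) * ((i + d + e + n).choose i : ℂ)) /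
      (((i + d).choose i : ℂ) * ((i + e).choose i : ℂ) * Ring.choose (i + b - c - n) i)) := by
  rw [outerFactor, poch_eq_sign_choose_nat (m := n) (by ring),
    poch_eq_choose (y := i + b) (by ring),
    poch_eq_sign_choose_nat (m := n + c) (by push_cast; ring),
    poch_eq_choose_nat (m := i + d + e + n) (x := 1 - n - (-n - d) - (-n - e))
      (by push_cast; ring),
    poch_eq_choose (y := i + b - c - n) (x := 1 + b + (-n - c)) (by ring),
    poch_eq_choose_nat (m := i + d) (by push_cast; ring),
    poch_eq_choose_nat (m := i + e) (by push_cast; ring),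
    mul_four_div_mul_four (natCast_factorial_ne_zero i)]
  rcases neg_one_pow_eq_or ℂ i with h | h <;> simp only [h] <;> ring

lemma outerFactor_second_second_second_second (n i b c d e : ℕ) :
    outerFactor n i (-n - b) (-n - c) (-n - d) (-n - e) = (n.choose i : ℂ) *
    ((((n + b).choose i : ℂ) * ((n + c).choose i : ℂ) * ((i + d + e + n).choose i : ℂ)) /
      (((i + d).choose i : ℂ) * ((i + e).choose i : ℂ) * ((2 * n + b + c).choose i : ℂ))) := by
  rw [outerFactor, poch_eq_sign_choose_nat (m := n) (by ring),
    poch_eq_sign_choose_nat (m := n + b) (by push_cast; ring),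
    poch_eq_sign_choose_nat (m := n + c) (by push_cast; ring),
    poch_eq_choose_nat (m := i + d + e + n) (x := 1 - n - (-n - d) - (-n - e))
      (by push_cast; ring),
    poch_eq_sign_choose_nat (m := 2 * n + b + c) (x := -n - b + (-n - c)) (by push_cast; ring),
    poch_eq_choose_nat (m := i + d) (by push_cast; ring),
    poch_eq_choose_nat (m := i + e) (by push_cast; ring),
    mul_four_div_mul_four (natCast_factorial_ne_zero i)]
  rcases neg_one_pow_eq_or ℂ i with h | h <;> simp only [h] <;> ring

lemma natCast_one_add_sub_add {n i : ℕ} (hi : i ≤ n) (d e j : ℕ) :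
    ((1 + d + e + n - i + j : ℕ) : ℂ) = 1 + d + (1 + e) + n - i + j - 1 := by
  rw [Nat.cast_add, Nat.cast_sub (by omega)]
  push_cast
  ring

lemma innerTerm_first_first_first_first {n i : ℕ} (hi : i ≤ n) (j d e f g : ℕ) :
    innerTerm n i j (1 + d) (1 + e) (1 + f) (1 + g) = (i.choose j : ℂ) *
      ((((j + d).choose j : ℂ) * ((j + e).choose j : ℂ) * ((1 + f + g + n).choose j : ℂ)) /
        (((n + f).choose j : ℂ) * ((n + g).choose j : ℂ) *
          ((1 + d + e + n - i + j).choose j : ℂ))) := by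
  rw [innerTerm, poch_eq_sign_choose_nat (m := i) (by ring),
    poch_eq_choose_nat (m := j + d) (by push_cast; ring),
    poch_eq_choose_nat (m := j + e) (by push_cast; ring),
    poch_eq_sign_choose_nat (m := 1 + f + g + n) (x := 1 - n - (1 + f) - (1 + g))
      (by push_cast; ring),
    poch_eq_choose_nat (x := 1 + d + (1 + e) + n - i) (natCast_one_add_sub_add hi d e j),
    poch_eq_sign_choose_nat (m := n + f) (by push_cast; ring),
    poch_eq_sign_choose_nat (m := n + g) (by push_cast; ring),
    mul_four_div_mul_four (natCast_factorial_ne_zero j)]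
  rcases neg_one_pow_eq_or ℂ j with h | h <;> simp only [h] <;> ring

lemma innerTerm_first_first_first_second {n i : ℕ} (hi : i ≤ n) (j d e f g : ℕ) :
    innerTerm n i j (1 + d) (1 + e) (1 + f) (-n - g) = (-1 : ℂ) ^ j * (i.choose j : ℂ) *
      ((((j + d).choose j : ℂ) * ((j + e).choose j : ℂ) * Ring.choose ((f : ℂ) - g) j) /
        (((n + f).choose j : ℂ) * ((j + g).choose j : ℂ) *
          ((1 + d + e + n - i + j).choose j : ℂ))) := by
  rw [innerTerm, poch_eq_sign_choose_nat (m := i) (by ring),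
    poch_eq_choose_nat (m := j + d) (by push_cast; ring),
    poch_eq_choose_nat (m := j + e) (by push_cast; ring),
    poch_eq_sign_choose (y := f - g) (x := 1 - n - (1 + f) - (-n - g)) (by ring),
    poch_eq_choose_nat (x := 1 + d + (1 + e) + n - i) (natCast_one_add_sub_add hi d e j),
    poch_eq_sign_choose_nat (m := n + f) (by push_cast; ring),
    poch_eq_choose_nat (m := j + g) (by push_cast; ring),
    mul_four_div_mul_four (natCast_factorial_ne_zero j)]
  rcases neg_one_pow_eq_or ℂ j with h | h <;> simp only [h] <;> ring

lemma innerTerm_first_first_second_second {n i : ℕ} (hi : i ≤ n) (j d e f g : ℕ) :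
    innerTerm n i j (1 + d) (1 + e) (-n - f) (-n - g) = (-1 : ℂ) ^ j * (i.choose j : ℂ) *
      ((((j + d).choose j : ℂ) * ((j + e).choose j : ℂ) * ((n + f + g + j).choose j : ℂ)) /
        (((j + f).choose j : ℂ) * ((j + g).choose j : ℂ) *
          ((1 + d + e + n - i + j).choose j : ℂ))) := by
  rw [innerTerm, poch_eq_sign_choose_nat (m := i) (by ring),
    poch_eq_choose_nat (m := j + d) (by push_cast; ring),
    poch_eq_choose_nat (m := j + e) (by push_cast; ring),
    poch_eq_choose_nat (m := n + f + g + j) (x := 1 - n - (-n - f) - (-n - g))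
      (by push_cast; ring),
    poch_eq_choose_nat (x := 1 + d + (1 + e) + n - i) (natCast_one_add_sub_add hi d e j),
    poch_eq_choose_nat (m := j + f) (by push_cast; ring),
    poch_eq_choose_nat (m := j + g) (by push_cast; ring),
    mul_four_div_mul_four (natCast_factorial_ne_zero j)]
  ring

lemma innerTerm_first_second_second_second (n i j : ℕ) (d : ℂ) (e f g : ℕ) :
    innerTerm n i j (1 + d) (-n - e) (-n - f) (-n - g) = (i.choose j : ℂ) *
      ((Ring.choose (j + d) j * ((n + e).choose j : ℂ) * ((j + f + g + n).choose j : ℂ)) /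
        (((j + f).choose j : ℂ) * ((j + g).choose j : ℂ) * Ring.choose (j + d - e - i) j)) := by
  rw [innerTerm, poch_eq_sign_choose_nat (m := i) (by ring),
    poch_eq_choose (y := j + d) (by ring),
    poch_eq_sign_choose_nat (m := n + e) (by push_cast; ring),
    poch_eq_choose_nat (m := j + f + g + n) (x := 1 - n - (-n - f) - (-n - g))
      (by push_cast; ring),
    poch_eq_choose (y := j + d - e - i) (x := 1 + d + (-n - e) + n - i) (by ring),
    poch_eq_choose_nat (m := j + f) (by push_cast; ring),
    poch_eq_choose_nat (m := j + g) (by push_cast; ring),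
    mul_four_div_mul_four (natCast_factorial_ne_zero j)]
  rcases neg_one_pow_eq_or ℂ j with h | h <;> simp only [h] <;> ring

lemma innerTerm_second_second_second_second (n i j d e f g : ℕ) :
    innerTerm n i j (-n - d) (-n - e) (-n - f) (-n - g) = (i.choose j : ℂ) *
      ((((n + d).choose j : ℂ) * ((n + e).choose j : ℂ) * ((j + f + g + n).choose j : ℂ)) /
        (((j + f).choose j : ℂ) * ((j + g).choose j : ℂ) * ((i + d + e + n).choose j : ℂ))) := by
  rw [innerTerm, poch_eq_sign_choose_nat (m := i) (by ring),
    poch_eq_sign_choose_nat (m := n + d) (by push_cast; ring),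
    poch_eq_sign_choose_nat (m := n + e) (by push_cast; ring),
    poch_eq_choose_nat (m := j + f + g + n) (x := 1 - n - (-n - f) - (-n - g))
      (by push_cast; ring),
    poch_eq_sign_choose_nat (m := i + d + e + n) (x := -n - d + (-n - e) + n - i)
      (by push_cast; ring),
    poch_eq_choose_nat (m := j + f) (by push_cast; ring),
    poch_eq_choose_nat (m := j + g) (by push_cast; ring),
    mul_four_div_mul_four (natCast_factorial_ne_zero j)]
  rcases neg_one_pow_eq_or ℂ j with h | h <;> simp only [h] <;> ring

lemma side6_eq (n b c d e f g : ℕ) : side6 n b c d e f g =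
    hyperSide n ![1 + f, 1 + g, 1 + d, 1 + e, 1 + b, 1 + c] := by
  rw [hyperSide_vec, side6, frontFactor_first_first]
  refine congrArg₂ _ rfl (Finset.sum_congr rfl fun i hi => ?_)
  rw [outerFactor_first_first_first_first]
  exact congrArg₂ _ rfl (Finset.sum_congr rfl fun j _ => (innerTerm_first_first_first_first
    (Nat.lt_succ_iff.1 (Finset.mem_range.1 hi)) j d e f g).symm)

lemma side5_eq (n b c d e f g : ℕ) : side5 n b c d e f g =
    hyperSide n ![1 + f, -n - g, 1 + d, 1 + e, 1 + b, 1 + c] := by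
  rw [hyperSide_vec, side5, frontFactor_first_first]
  refine congrArg₂ _ rfl (Finset.sum_congr rfl fun i hi => ?_)
  rw [outerFactor_first_first_first_first]
  exact congrArg₂ _ rfl (Finset.sum_congr rfl fun j _ => (innerTerm_first_first_first_second
    (Nat.lt_succ_iff.1 (Finset.mem_range.1 hi)) j d e f g).symm)

lemma side4_eq (n b c d e f g : ℕ) : side4 n b c d e f g =
    hyperSide n ![-n - f, -n - g, 1 + d, 1 + e, 1 + b, 1 + c] := by
  rw [hyperSide_vec, side4, frontFactor_first_first]
  refine congrArg₂ _ rfl (Finset.sum_congr rfl fun i hi => ?_)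
  rw [outerFactor_first_first_first_first]
  exact congrArg₂ _ rfl (Finset.sum_congr rfl fun j _ => (innerTerm_first_first_second_second
    (Nat.lt_succ_iff.1 (Finset.mem_range.1 hi)) j d e f g).symm)

lemma side3_eq (n b c : ℕ) (d : ℂ) (e f g : ℕ) : side3 n b c d e f g =
    hyperSide n ![-n - f, -n - g, 1 + d, -n - e, 1 + b, 1 + c] := by
  rw [hyperSide_vec, side3, frontFactor_first_first]
  refine congrArg₂ _ rfl (Finset.sum_congr rfl fun i _ => ?_)
  rw [outerFactor_first_first_first_second]
  exact congrArg₂ _ rfl (Finset.sum_congr rfl fun j _ =>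
    (innerTerm_first_second_second_second n i j d e f g).symm)

lemma side2_eq (n b c d e f g : ℕ) : side2 n b c d e f g =
    hyperSide n ![-n - f, -n - g, -n - d, -n - e, 1 + b, 1 + c] := by
  rw [hyperSide_vec, side2, frontFactor_first_first]
  refine congrArg₂ _ rfl (Finset.sum_congr rfl fun i _ => ?_)
  rw [outerFactor_first_first_second_second]
  exact congrArg₂ _ rfl (Finset.sum_congr rfl fun j _ =>
    (innerTerm_second_second_second_second n i j d e f g).symm)

lemma side1_eq (n : ℕ) (b : ℂ) (c d e f g : ℕ) : side1 n b c d e f g =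
    hyperSide n ![-n - f, -n - g, -n - d, -n - e, 1 + b, -n - c] := by
  rw [hyperSide_vec, side1, frontFactor_first_second]
  refine congrArg₂ _ rfl (Finset.sum_congr rfl fun i _ => ?_)
  rw [outerFactor_first_second_second_second]
  exact congrArg₂ _ rfl (Finset.sum_congr rfl fun j _ =>
    (innerTerm_second_second_second_second n i j d e f g).symm)

lemma side0_eq (n b c d e f g : ℕ) : side0 n b c d e f g =
    hyperSide n ![-n - f, -n - g, -n - d, -n - e, -n - b, -n - c] := by
  rw [hyperSide_vec, side0, frontFactor_second_second]
  refine congrArg₂ _ rfl (Finset.sum_congr rfl fun i _ => ?_)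
  rw [outerFactor_second_second_second_second]
  exact congrArg₂ _ rfl (Finset.sum_congr rfl fun j _ =>
    (innerTerm_second_second_second_second n i j d e f g).symm)

/-- The well-poised sum is symmetric in its parameters; the double sums use the pairs of
parameters in the opposite order. -/
lemma wellPoisedSum_reverse_pairs (n : ℕ) (x₀ x₁ x₂ x₃ x₄ x₅ : ℂ) :
    wellPoisedSum n ![x₀, x₁, x₂, x₃, x₄, x₅] = wellPoisedSum n ![x₄, x₅, x₂, x₃, x₀, x₁] := by
  unfold wellPoisedSum
  refine Finset.sum_congr rfl fun k _ => ?_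
  simp only [Fin.prod_univ_six, Fin.sum_univ_six]
  simp only [Matrix.cons_val]
  ring

/-! ### The parameters with the pairs reversed -/

/-- The parameters with the three pairs in the opposite order. -/
noncomputable def reversedParam (n v : ℕ) (P : Fin 6 → ℕ) : Fin 6 → ℂ :=
  ![param n v P 4, param n v P 5, param n v P 2, param n v P 3, param n v P 0, param n v P 1]

lemma harmonicSum_eq_wellPoisedSum (n v : ℕ) (P : Fin 6 → ℕ) :
    harmonicSum n v P = wellPoisedSum n (reversedParam n v P) := by
  rw [← wellPoisedSum_param, reversedParam, ← wellPoisedSum_reverse_pairs]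
  congr 1
  funext s
  fin_cases s <;> rfl

lemma poch_one_sub_reversedParam_ne_zero (n v : ℕ) (P : Fin 6 → ℕ) (s : Fin 6) :
    poch (1 - n - reversedParam n v P s) n ≠ 0 := by
  fin_cases s <;> exact poch_one_sub_param_ne_zero n v P _

lemma regular_reversedParam {n v : ℕ} {P : Fin 6 → ℕ}
    (h3 : ¬ (v = 3 ∧ P 3 ≤ P 2 ∧ P 2 < P 3 + n)) (h1 : ¬ (v = 1 ∧ P 1 ≤ P 0 ∧ P 0 < P 1 + n)) :
    Regular n (reversedParam n v P) := by
  have e : ((0 : Fin 6) : ℕ) = 0 ∧ ((1 : Fin 6) : ℕ) = 1 ∧ ((2 : Fin 6) : ℕ) = 2 ∧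
    ((3 : Fin 6) : ℕ) = 3 := ⟨rfl, rfl, rfl, rfl⟩
  refine regular_of (poch_one_sub_reversedParam_ne_zero n v P) ?_ fun i hi => ?_
  · change poch (param n v P 0 + param n v P 1) n ≠ 0
    refine poch_ne_zero_of_int _ (by rw [param_eq_intCast, param_eq_intCast, ← Int.cast_add])
      fun l hl => ?_
    split_ifs <;> omega
  · change poch (param n v P 2 + param n v P 3 + n - i) i ≠ 0
    refine poch_ne_zero_of_int ((if ((2 : Fin 6) : ℕ) < v then 1 + (P 2 : ℤ) else -n - P 2) +
      (if ((3 : Fin 6) : ℕ) < v then 1 + (P 3 : ℤ) else -n - P 3) + n - i)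
      (by rw [param_eq_intCast, param_eq_intCast]; push_cast; rfl) fun l hl => ?_
    split_ifs <;> omega

lemma harmonicSum_eq_hyperSide {n v : ℕ} {P : Fin 6 → ℕ}
    (h3 : ¬ (v = 3 ∧ P 3 ≤ P 2 ∧ P 2 < P 3 + n)) (h1 : ¬ (v = 1 ∧ P 1 ≤ P 0 ∧ P 0 < P 1 + n)) :
    harmonicSum n v P = hyperSide n (reversedParam n v P) := by
  rw [harmonicSum_eq_wellPoisedSum, wellPoisedSum_eq_hyperSide (regular_reversedParam h3 h1)]

/-- The limit of `hyperSide` along a curve that is regular apart from one point. -/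
lemma tendsto_hyperSide_curve {n : ℕ} {T : ℂ → Fin 6 → ℂ} {d : ℂ} (hT : Continuous T)
    (h : ∀ s, poch (1 - n - T d s) n ≠ 0)
    (h45 : ∀ᶠ x in 𝓝[≠] d, poch (T x 4 + T x 5) n ≠ 0)
    (h23 : ∀ i : ℕ, ∀ᶠ x in 𝓝[≠] d, poch (T x 2 + T x 3 + n - i) i ≠ 0) :
    Tendsto (fun x => hyperSide n (T x)) (𝓝[≠] d) (𝓝 (wellPoisedSum n (T d))) := by
  have hc : ContinuousAt (fun x => wellPoisedSum n (T x)) d :=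
    ContinuousAt.comp (g := wellPoisedSum n) (continuousAt_wellPoisedSum h) hT.continuousAt
  refine (hc.tendsto.mono_left nhdsWithin_le_nhds).congr' ?_
  have h1 : ∀ᶠ x in 𝓝[≠] d, ∀ s, poch (1 - n - T x s) n ≠ 0 :=
    nhdsWithin_le_nhds (Filter.eventually_all.2 fun s =>
      ContinuousAt.eventually_ne (Continuous.continuousAt (by fun_prop)) (h s))
  have h2 : ∀ᶠ x in 𝓝[≠] d, ∀ i ∈ Finset.range (n + 1), poch (T x 2 + T x 3 + n - i) i ≠ 0 :=
    (Finset.eventually_all _).2 fun i _ => h23 i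
  filter_upwards [h45, h1, h2] with x h45 h1 h2
  exact wellPoisedSum_eq_hyperSide (regular_of h1 h45 fun i hi =>
    h2 i (Finset.mem_range.2 (Nat.lt_succ_of_le hi)))

lemma reversedParam_three (n b c d e f g : ℕ) : reversedParam n 3 ![b, c, d, e, f, g] =
    (![-n - f, -n - g, 1 + d, -n - e, 1 + b, 1 + c] : Fin 6 → ℂ) := by
  simp [reversedParam, param]

lemma reversedParam_one (n b c d e f g : ℕ) : reversedParam n 1 ![b, c, d, e, f, g] =
    (![-n - f, -n - g, -n - d, -n - e, 1 + b, -n - c] : Fin 6 → ℂ) := by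
  simp [reversedParam, param]

lemma tendsto_side3 (n b c d e f g : ℕ) :
    Tendsto (fun x : ℂ => side3 n b c x e f g) (𝓝[≠] (d : ℂ))
      (𝓝 (harmonicSum n 3 ![b, c, d, e, f, g])) := by
  have h := poch_one_sub_reversedParam_ne_zero n 3 ![b, c, d, e, f, g]
  rw [harmonicSum_eq_wellPoisedSum]
  rw [reversedParam_three] at h ⊢
  simp only [side3_eq]
  refine tendsto_hyperSide_curve
    (T := fun x : ℂ => ![-n - f, -n - g, 1 + x, -n - e, 1 + b, 1 + c])
    (by fun_prop) h (Eventually.of_forall fun x => ?_) fun i => ?_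
  · exact poch_ne_zero_of_int (2 + b + c)
      (by simp only [Matrix.cons_val]; push_cast; ring) fun l hl => by omega
  · filter_upwards [eventually_poch_ne_zero (1 - e - i) 1 d one_ne_zero i] with x hx
    convert hx using 2
    simp only [Matrix.cons_val]
    ring

lemma tendsto_side1 (n b c d e f g : ℕ) :
    Tendsto (fun x : ℂ => side1 n x c d e f g) (𝓝[≠] (b : ℂ))
      (𝓝 (harmonicSum n 1 ![b, c, d, e, f, g])) := by
  have h := poch_one_sub_reversedParam_ne_zero n 1 ![b, c, d, e, f, g]
  rw [harmonicSum_eq_wellPoisedSum]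
  rw [reversedParam_one] at h ⊢
  simp only [side1_eq]
  have hreg : ∀ i : ℕ, poch (-(n : ℂ) - d - e - i) i ≠ 0 := fun i =>
    poch_ne_zero_of_int (-n - d - e - i) (by push_cast; ring) fun l hl => by omega
  refine tendsto_hyperSide_curve
    (T := fun x : ℂ => ![-n - f, -n - g, -n - d, -n - e, 1 + x, -n - c])
    (by fun_prop) h ?_ fun i => Eventually.of_forall fun x => ?_
  · filter_upwards [eventually_poch_ne_zero (1 - n - c) 1 b one_ne_zero n] with x hx
    convert hx using 2
    simp only [Matrix.cons_val]
    ring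
  · convert hreg i using 2
    simp only [Matrix.cons_val]
    ring

lemma choose_ne_zero_of_regular_three {n b c d e f g : ℕ}
    (h : Regular n (reversedParam n 3 ![b, c, d, e, f, g])) {i j : ℕ} (hi : i ≤ n) (hj : j ≤ i) :
    Ring.choose ((j : ℂ) + d - e - i) j ≠ 0 := by
  have h0 := ((h.2.2 i hi).2.2.2 j hj).1
  rw [reversedParam_three] at h0
  simp only [Matrix.cons_val] at h0
  rw [poch_eq_choose (y := (j : ℂ) + d - e - i) (by ring)] at h0
  exact right_ne_zero_of_mul h0

lemma choose_ne_zero_of_regular_one {n b c d e f g : ℕ}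
    (h : Regular n (reversedParam n 1 ![b, c, d, e, f, g])) {i : ℕ} (hi : i ≤ n) :
    Ring.choose ((i : ℂ) + b - c - n) i ≠ 0 := by
  have h0 := (h.2.2 i hi).1
  rw [reversedParam_one] at h0
  simp only [Matrix.cons_val] at h0
  rw [poch_eq_choose (y := (i : ℂ) + b - c - n) (by ring)] at h0
  exact right_ne_zero_of_mul h0

end HarmonicSum

theorem mainTheorem8 (n : ℕ) :
    -- The general identity: literally when no denominator vanishes, and in all cases as a limit.
    (∀ (v : ℕ), v ≤ 6 → ∀ (P : Fin 6 → ℕ),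
      (¬ (v = 3 ∧ P 3 ≤ P 2 ∧ P 2 < P 3 + n) → ¬ (v = 5 ∧ P 5 ≤ P 4 ∧ P 4 < P 5 + n) →
        HarmonicSum.Regular n (HarmonicSum.param n v P) ∧
        HarmonicSum.harmonicSum n v P = HarmonicSum.hyperSide n (HarmonicSum.param n v P)) ∧
      HarmonicSum.param n v P ∈ closure {T : Fin 6 → ℂ | HarmonicSum.Regular n T} ∧
      Tendsto (HarmonicSum.hyperSide n)
        (𝓝[{T : Fin 6 → ℂ | HarmonicSum.Regular n T}] (HarmonicSum.param n v P))
        (𝓝 (HarmonicSum.harmonicSum n v P))) ∧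
    -- The seven identities of Chu-Donno type.
    (∀ b c d e f g : ℕ,
      HarmonicSum.harmonicSum n 6 ![b, c, d, e, f, g] = HarmonicSum.side6 n b c d e f g ∧
      HarmonicSum.harmonicSum n 5 ![b, c, d, e, f, g] = HarmonicSum.side5 n b c d e f g ∧
      HarmonicSum.harmonicSum n 4 ![b, c, d, e, f, g] = HarmonicSum.side4 n b c d e f g ∧
      ((¬ (e ≤ d ∧ d < e + n) →
          (∀ i ≤ n, ∀ j ≤ i, Ring.choose ((j : ℂ) + d - e - i) j ≠ 0) ∧
          HarmonicSum.harmonicSum n 3 ![b, c, d, e, f, g] =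
            HarmonicSum.side3 n b c (d : ℂ) e f g) ∧
        Tendsto (fun x : ℂ => HarmonicSum.side3 n b c x e f g) (𝓝[≠] (d : ℂ))
          (𝓝 (HarmonicSum.harmonicSum n 3 ![b, c, d, e, f, g]))) ∧
      HarmonicSum.harmonicSum n 2 ![b, c, d, e, f, g] = HarmonicSum.side2 n b c d e f g ∧
      ((¬ (c ≤ b ∧ b < c + n) →
          (∀ i ≤ n, Ring.choose ((i : ℂ) + b - c - n) i ≠ 0) ∧
          HarmonicSum.harmonicSum n 1 ![b, c, d, e, f, g] =
            HarmonicSum.side1 n (b : ℂ) c d e f g) ∧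
        Tendsto (fun x : ℂ => HarmonicSum.side1 n x c d e f g) (𝓝[≠] (b : ℂ))
          (𝓝 (HarmonicSum.harmonicSum n 1 ![b, c, d, e, f, g]))) ∧
      HarmonicSum.harmonicSum n 0 ![b, c, d, e, f, g] = HarmonicSum.side0 n b c d e f g) := by
  open HarmonicSum in
  refine ⟨fun v _ P => ⟨fun h3 h5 => ⟨regular_param h3 h5, ?_⟩, mem_closure_regular n _,
    tendsto_hyperSide n v P⟩, fun b c d e f g => ⟨?_, ?_, ?_,
    ⟨fun h => ?_, tendsto_side3 n b c d e f g⟩,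
    ?_, ⟨fun h => ?_, tendsto_side1 n b c d e f g⟩, ?_⟩⟩
  · rw [← wellPoisedSum_param, wellPoisedSum_eq_hyperSide (regular_param h3 h5)]
  · rw [harmonicSum_eq_hyperSide (by simp) (by simp), side6_eq]
    simp [reversedParam, param]
  · rw [harmonicSum_eq_hyperSide (by simp) (by simp), side5_eq]
    simp [reversedParam, param]
  · rw [harmonicSum_eq_hyperSide (by simp) (by simp), side4_eq]
    simp [reversedParam, param]
  · have h3 : ¬ (3 = 3 ∧ ![b, c, d, e, f, g] 3 ≤ ![b, c, d, e, f, g] 2 ∧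
        ![b, c, d, e, f, g] 2 < ![b, c, d, e, f, g] 3 + n) := fun h' => h h'.2
    refine ⟨fun i hi j hj =>
      choose_ne_zero_of_regular_three (regular_reversedParam h3 (by simp)) hi hj, ?_⟩
    rw [harmonicSum_eq_hyperSide h3 (by simp), side3_eq, reversedParam_three]
  · rw [harmonicSum_eq_hyperSide (by simp) (by simp), side2_eq]
    simp [reversedParam, param]
  · have h1 : ¬ (1 = 1 ∧ ![b, c, d, e, f, g] 1 ≤ ![b, c, d, e, f, g] 0 ∧
        ![b, c, d, e, f, g] 0 < ![b, c, d, e, f, g] 1 + n) := fun h' => h h'.2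
    refine ⟨fun i hi => choose_ne_zero_of_regular_one (regular_reversedParam (by simp) h1) hi, ?_⟩
    rw [harmonicSum_eq_hyperSide (by simp) h1, side1_eq, reversedParam_one]
  · rw [harmonicSum_eq_hyperSide (by simp) (by simp), side0_eq]
    simp [reversedParam, param]
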